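/- Let $G$ be a finite-dimensional Lie group with identity $e$ and Lie algebra $\mathfrak g=T_eG$, let $H\subseteq G$ be a closed subgroup with Lie algebra $\mathfrak h$, and let $\mathcal M=G/H$ carry the manifold structure for which the projection $\pi\colon G\to G/H$, $g\mapsto gH$, is a smooth submersion. Let $G$ act on $\mathcal M$ by $\Lambda^g(kH)=g.kH=(gk)H$. Assume that $\mathcal M$ is reductive, and fix a reductive complement, i.e. a linear subspace $\mathfrak m\subseteq\mathfrak g$ with $\mathfrak g=\mathfrak h\oplus\mathfrak m$ and $\mathrm{Ad}(h)\mathfrak m\subseteq\mathfrak m$ for all $h\in H$. Let $\omega_e\colon T_{eH}\mathcal M\to\mathfrak m$ be the inverse of $T_e\pi|_{\mathfrak m}$, and put $$\omega(v)=\mathrm{Ad}(g).\,\omega_e\bigl(T\Lambda^{g^{-1}}(v)\bigr)\qquad\text{for } v\in T_{gH}\mathcal M,\ g\in G.$$ Let $I=[0,1]$, let $D(c)=\dot c$ and $\theta_\omega(f)=\omega\circ f$. For a smooth curve $q\colon I\to\mathfrak g$ let $\mathrm{Evol}(q)\colon I\to G$ be the smooth solution $g$ of $\dot g(t)=T_eR_{g(t)}(q(t))$,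 $g(0)=e$, where $R_a(x)=xa$, and for $c_0\in\mathcal M$ put $\rho_{c_0}(q)(t)=\mathrm{Evol}(q)(t).c_0$. Let $C^\infty_{c_0}(I,\mathcal M)$ be the set of smooth curves $c\colon I\to\mathcal M$ with $c(0)=c_0$. Then, for every $c_0\in\mathcal M$: * $\omega$ is well defined: for $v\in T_{gH}\mathcal M$ the value $\omega(v)$ does not depend on the representative $g$ of the coset; * for every $c\in C^\infty_{c_0}(I,\mathcal M)$ the curve $\theta_\omega(D(c))=\omega(\dot c)\colon I\to\mathfrak g$ is smooth, and the initial value problem defining $\mathrm{Evol}(\omega(\dot c))$ has exactly one smooth solution on $I$; * $\rho_{c_0}\circ\theta_\omega\circ D=\mathrm{id}_{C^\infty_{c_0}(I,\mathcal M)}$, that is, $\mathrm{Evol}(\omega(\dot c))(t).c_0=c(t)$ for all $c\in C^\infty_{c_0}(I,\mathcal M)$ and $t\in I$. -/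

import Mathlib

open Set
open scoped Manifold ContDiff Topology

noncomputable section

namespace ReductiveSpace

section Curves

variable {E : Type*} [NormedAddCommGroup E] [NormedSpace ℝ E]
  {M : Type*} [TopologicalSpace M] [ChartedSpace E M]

/-- The velocity `ċ(t) ∈ T_{c(t)} M` of a curve `c : [0,1] → M`: the image under the derivative of
`c` of the unit tangent vector `1` (the direction of increasing parameter) of `[0,1]` at `t`.
At the end points this is the one-sided derivative. -/
def velocity (c : unitInterval → M) (t : unitInterval) : TangentSpace 𝓘(ℝ, E) (c t) :=
  mfderiv (𝓡∂ 1) 𝓘(ℝ, E) c t 1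

variable (E) in
/-- The differentiation map `D : c ↦ ċ`, with values in curves in the tangent bundle. -/
def derivCurve (c : unitInterval → M) : unitInterval → TangentBundle 𝓘(ℝ, E) M :=
  fun t => ⟨c t, velocity c t⟩

variable (E) in
/-- The set `C^∞_{c₀}([0,1], M)` of smooth curves starting at `c₀`. -/
def smoothCurvesFrom (c₀ : M) : Set (unitInterval → M) :=
  {c | ContMDiff (𝓡∂ 1) 𝓘(ℝ, E) ∞ c ∧ c 0 = c₀}

end Curves

section LieGroup

variable (E : Type*) [NormedAddCommGroup E] [NormedSpace ℝ E]
  {G : Type*} [TopologicalSpace G] [ChartedSpace E G] [Group G]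

variable (G) in
/-- The set `C^∞([0,1], 𝔤)`. As a topological vector space the Lie algebra `𝔤 = T_e G` is the model
space `E`, whose norm is used to express smoothness. -/
def smoothLieCurves : Set (unitInterval → GroupLieAlgebra 𝓘(ℝ, E) G) :=
  {q | ContMDiff (M' := E) (𝓡∂ 1) 𝓘(ℝ, E) ∞ q}

/-- The adjoint action `Ad(g) = T_e conj_g` with `conj_g x = g x g⁻¹`. -/
def Ad (g : G) : GroupLieAlgebra 𝓘(ℝ, E) G →L[ℝ] GroupLieAlgebra 𝓘(ℝ, E) G :=
  mfderiv 𝓘(ℝ, E) 𝓘(ℝ, E) (fun x : G => g * x * g⁻¹) 1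

/-- The right translation `(R_g)_* = T_e R_g : 𝔤 → T_g G`. -/
def rightTranslate (g : G) : GroupLieAlgebra 𝓘(ℝ, E) G →L[ℝ] TangentSpace 𝓘(ℝ, E) g :=
  mfderiv 𝓘(ℝ, E) 𝓘(ℝ, E) (fun x : G => x * g) 1

/-- `g : [0,1] → G` is a smooth solution of `ġ(t) = (R_{g(t)})_* q(t)`, `g(0) = e`. -/
structure IsEvolution (q : unitInterval → GroupLieAlgebra 𝓘(ℝ, E) G) (g : unitInterval → G) :
    Prop where
  smooth : ContMDiff (𝓡∂ 1) 𝓘(ℝ, E) ∞ g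
  start : g 0 = 1
  deriv_eq : ∀ t, velocity g t = rightTranslate E (g t) (q t)

open Classical in
/-- The evolution operator: `Evol q` is the solution `g` of the above initial value problem
(with the dummy value `1` when there is none). -/
def Evol (q : unitInterval → GroupLieAlgebra 𝓘(ℝ, E) G) : unitInterval → G :=
  if h : ∃ g, IsEvolution E q g then h.choose else fun _ => 1

section LieAlgebraOfSubgroup

variable (H : Subgroup G)

/-- `X ∈ T_e G` is the velocity at time `0` of a curve in `G` which passes through `e` at time `0`,
is smooth there and stays in `H`. -/
def IsTangentToSubgroup (X : GroupLieAlgebra 𝓘(ℝ, E) G) : Prop :=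
  ∃ γ : ℝ → G, (∀ t, γ t ∈ H) ∧ ContMDiffAt 𝓘(ℝ, ℝ) 𝓘(ℝ, E) ∞ γ 0 ∧ γ 0 = 1 ∧
    mfderiv 𝓘(ℝ, ℝ) 𝓘(ℝ, E) γ 0 (1 : ℝ) = X

theorem IsTangentToSubgroup.zero : IsTangentToSubgroup E H 0 := by
  refine ⟨fun _ => 1, fun _ => H.one_mem, contMDiffAt_const, rfl, ?_⟩
  rw [mfderiv_const]
  rfl

theorem IsTangentToSubgroup.smul {X : GroupLieAlgebra 𝓘(ℝ, E) G} (a : ℝ)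
    (hX : IsTangentToSubgroup E H X) : IsTangentToSubgroup E H (a • X) := by
  obtain ⟨γ, hH, hs, h1, hd⟩ := hX
  have hlin : ContMDiff 𝓘(ℝ, ℝ) 𝓘(ℝ, ℝ) ∞ (fun t : ℝ => a * t) :=
    (contDiff_const.mul contDiff_id).contMDiff
  have hs' : ContMDiffAt 𝓘(ℝ, ℝ) 𝓘(ℝ, E) ∞ γ (a * 0) := by simpa using hs
  refine ⟨fun t => γ (a * t), fun t => hH _, hs'.comp (0 : ℝ) hlin.contMDiffAt, by simpa using h1, ?_⟩
  have hdg : MDifferentiableAt 𝓘(ℝ, ℝ) 𝓘(ℝ, E) γ (a * 0) := hs'.mdifferentiableAt (by simp)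
  have hdl : MDifferentiableAt 𝓘(ℝ, ℝ) 𝓘(ℝ, ℝ) (fun t : ℝ => a * t) 0 :=
    (hlin.contMDiffAt).mdifferentiableAt (by simp)
  have hfd : mfderiv 𝓘(ℝ, ℝ) 𝓘(ℝ, ℝ) (fun t : ℝ => a * t) 0 (1 : ℝ) = a • (1 : ℝ) := by
    have h : HasDerivAt (fun t : ℝ => a * t) a 0 := by
      simpa using (hasDerivAt_id (0 : ℝ)).const_mul a
    have h' : fderiv ℝ (fun t : ℝ => a * t) 0 (1 : ℝ) = a • (1 : ℝ) := by
      rw [fderiv_eq_smul_deriv, h.deriv]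
      simp
    rw [mfderiv_eq_fderiv]
    exact h'
  have key := mfderiv_comp_apply (I'' := 𝓘(ℝ, E)) (0 : ℝ) hdg hdl (1 : ℝ)
  have hz : mfderiv 𝓘(ℝ, ℝ) 𝓘(ℝ, E) γ (a * 0) (1 : ℝ) = X := by
    rw [← hd, mul_zero]
  have hs1 : mfderiv 𝓘(ℝ, ℝ) 𝓘(ℝ, E) γ (a * 0) (a • (1 : ℝ)) =
      a • mfderiv 𝓘(ℝ, ℝ) 𝓘(ℝ, E) γ (a * 0) (1 : ℝ) :=
    (mfderiv 𝓘(ℝ, ℝ) 𝓘(ℝ, E) γ (a * 0)).map_smul a (1 : ℝ)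
  refine key.trans ((congrArg _ hfd).trans (hs1.trans ?_))
  exact congrArg (fun v : E => a • v) hz

variable [LieGroup 𝓘(ℝ, E) ∞ G]

theorem IsTangentToSubgroup.add {X Y : GroupLieAlgebra 𝓘(ℝ, E) G}
    (hX : IsTangentToSubgroup E H X) (hY : IsTangentToSubgroup E H Y) :
    IsTangentToSubgroup E H (X + Y) := by
  obtain ⟨γ, hH, hs, h1, hd⟩ := hX
  obtain ⟨δ, hH', hs', h1', hd'⟩ := hY
  refine ⟨fun t => γ t * δ t, fun t => H.mul_mem (hH t) (hH' t), hs.mul hs', by simp [h1, h1'], ?_⟩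
  have hdg : MDifferentiableAt 𝓘(ℝ, ℝ) 𝓘(ℝ, E) γ 0 := hs.mdifferentiableAt (by simp)
  have hdd : MDifferentiableAt 𝓘(ℝ, ℝ) 𝓘(ℝ, E) δ 0 := hs'.mdifferentiableAt (by simp)
  have hmul : MDifferentiableAt (𝓘(ℝ, E).prod 𝓘(ℝ, E)) 𝓘(ℝ, E) (fun p : G × G => p.1 * p.2)
      (γ 0, δ 0) :=
    (contMDiff_mul 𝓘(ℝ, E) ∞).contMDiffAt.mdifferentiableAt (by simp)
  have key := mfderiv_comp_apply (I'' := 𝓘(ℝ, E)) (0 : ℝ) hmul (hdg.prodMk hdd) (1 : ℝ)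
  rw [mfderiv_prod_eq_add_apply hmul] at key
  have hp := hdg.mfderiv_prod hdd
  have e1 : ∀ u : E, mfderiv 𝓘(ℝ, E) 𝓘(ℝ, E) (fun z : G => z * δ 0) (γ 0) u = u := by
    intro u
    have : (fun z : G => z * δ 0) = id := by funext z; simp [h1']
    rw [this, mfderiv_id]
    rfl
  have e2 : ∀ u : E, mfderiv 𝓘(ℝ, E) 𝓘(ℝ, E) (fun z : G => γ 0 * z) (δ 0) u = u := by
    intro u
    have : (fun z : G => γ 0 * z) = id := by funext z; simp [h1]
    rw [this, mfderiv_id]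
    rfl
  rw [hp] at key
  rw [← hd, ← hd']
  exact key.trans (congrArg₂ (fun u v : E => u + v) (e1 _) (e2 _))

/-- The Lie algebra `𝔥` of a closed subgroup `H`, as a subspace of `𝔤`: the tangent space of `H`
at `e`. -/
def lieAlgebraOf : Submodule ℝ (GroupLieAlgebra 𝓘(ℝ, E) G) where
  carrier := {X | IsTangentToSubgroup E H X}
  zero_mem' := IsTangentToSubgroup.zero E H
  add_mem' := IsTangentToSubgroup.add E H
  smul_mem' a _ := IsTangentToSubgroup.smul E H a

/-- `𝔪` is a reductive complement of `𝔥`: `𝔤 = 𝔥 ⊕ 𝔪` and `Ad(h) 𝔪 ⊆ 𝔪` for all `h ∈ H`. -/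
structure IsReductiveComplement (m : Submodule ℝ (GroupLieAlgebra 𝓘(ℝ, E) G)) : Prop where
  isCompl : IsCompl (lieAlgebraOf E H) m
  ad_mem : ∀ h ∈ H, ∀ X ∈ m, Ad E h X ∈ m

end LieAlgebraOfSubgroup

section HomogeneousSpace

variable {H : Subgroup G}

/-- `ρ_{c₀}(q)(t) = Evol(q)(t) . c₀`, for the action of `G` on `G/H` by left translation. -/
def rho (c₀ : G ⧸ H) (q : unitInterval → GroupLieAlgebra 𝓘(ℝ, E) G) : unitInterval → G ⧸ H :=
  fun t => Evol E q t • c₀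

variable (F : Type*) [NormedAddCommGroup F] [NormedSpace ℝ F] [ChartedSpace F (G ⧸ H)]

/-- `T Λ^g : T_x (G/H) → T_{g.x} (G/H)`, the derivative of the translation `Λ^g x = g . x`. -/
def translate (g : G) (x : G ⧸ H) :
    TangentSpace 𝓘(ℝ, F) x →L[ℝ] TangentSpace 𝓘(ℝ, F) (g • x) :=
  mfderiv 𝓘(ℝ, F) 𝓘(ℝ, F) (fun y : G ⧸ H => g • y) x

/-- `ω_e : T_{eH} (G/H) → 𝔪 ⊆ 𝔤`, the inverse of the restriction to `𝔪` of the derivative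
`T_e π : 𝔤 → T_{eH} (G/H)` of the projection `π : G → G/H`. -/
def omegaAtBase (m : Submodule ℝ (GroupLieAlgebra 𝓘(ℝ, E) G)) :
    TangentSpace 𝓘(ℝ, F) ((1 : G) : G ⧸ H) →L[ℝ] GroupLieAlgebra 𝓘(ℝ, E) G :=
  m.subtypeL ∘L
    ((mfderiv 𝓘(ℝ, E) 𝓘(ℝ, F) (fun x : G => (x : G ⧸ H)) 1) ∘L m.subtypeL).inverse

/-- The value `Ad(g) ω_e (T Λ^{g⁻¹} v)` for `v ∈ T_x (G/H)`, where `g` is meant to be a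
representative of the coset `x`, so that `g⁻¹ . x = eH`. -/
def omegaVia (m : Submodule ℝ (GroupLieAlgebra 𝓘(ℝ, E) G)) (g : G)
    (v : TangentBundle 𝓘(ℝ, F) (G ⧸ H)) : GroupLieAlgebra 𝓘(ℝ, E) G :=
  Ad E g (omegaAtBase (H := H) E F m (translate F g⁻¹ v.1 v.2))

/-- The canonical `𝔤`-valued one-form `ω(v) = Ad(g) ω_e (T Λ^{g⁻¹} v)`, `v ∈ T_{gH} (G/H)`,
evaluated with some representative `g` of the coset. -/
def omega (m : Submodule ℝ (GroupLieAlgebra 𝓘(ℝ, E) G)) (v : TangentBundle 𝓘(ℝ, F) (G ⧸ H)) :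
    GroupLieAlgebra 𝓘(ℝ, E) G :=
  omegaVia E F m v.1.out v

/-- Postcomposition `θ_ω(f) = ω ∘ f` with the one-form `ω`. -/
def thetaOmega (m : Submodule ℝ (GroupLieAlgebra 𝓘(ℝ, E) G))
    (f : unitInterval → TangentBundle 𝓘(ℝ, F) (G ⧸ H)) :
    unitInterval → GroupLieAlgebra 𝓘(ℝ, E) G :=
  fun t => omega E F m (f t)

end HomogeneousSpace

end LieGroup

end ReductiveSpace

end

/-! The main tool is the right logarithmic derivative of a curve in `G`: the velocity at `r = t` of
`r ↦ g(r) g(t)⁻¹`, a curve through the identity. It is unchanged by right multiplication with a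
constant.

Let `P = ω_e ∘ T_eπ` be the projection of `𝔤` onto `𝔪` along `ker T_eπ = 𝔥`
(`derivProj_eq_zero_iff`). A local section of the submersion `π` lifts `c` locally to a smooth curve
`a` in `G`, with right logarithmic derivative `X`. Translating by `a(t)⁻¹` turns `c` into the
projection of `a(t)⁻¹ a(r)`, whose velocity at the identity is `Ad(a(t)⁻¹) X`. Hence `ω(ċ) = Ad(a) P
Ad(a⁻¹) X` (`omegaVia_eq`), and the three claims follow from this formula.

Well-definedness: passing from `a` to `a h` with `h ∈ H` keeps `X`, and `P` commutes with `Ad(h)`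
because both `𝔪` and `ker T_eπ` are `Ad(H)`-stable (`complementProj_Ad`). Smoothness: `Ad` is smooth
along smooth curves and `X` is smooth.

Reconstruction: let `g` be the evolution of `q = ω(ċ)`. Moved to the identity, `g⁻¹ a` has velocity
`Ad(a⁻¹)(X - q)`. Since `Ad(a⁻¹) q = P Ad(a⁻¹) X` and `T_eπ ∘ P = T_eπ`, the projection kills it. So
`g⁻¹.c` has zero velocity and stays equal to `c(0)` (`IsEvolution.smul_eq`).

Evolutions exist by Picard–Lindelöf in the chart at the identity; right invariance lets local
solutions be glued. They are unique because the quotient `g⁻¹ k` of two solutions has zero velocity.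
-/

noncomputable section

namespace ReductiveSpace

/-! ### Velocities of curves in manifolds -/

section VelocityCalculus

variable {E : Type*} [NormedAddCommGroup E] [NormedSpace ℝ E]
  {F : Type*} [NormedAddCommGroup F] [NormedSpace ℝ F]
  {M : Type*} [TopologicalSpace M] [ChartedSpace E M]
  {N : Type*} [TopologicalSpace N] [ChartedSpace F N]

/-- The curve `f` has velocity `v` at time `t`, relative to the set of times `s`. -/
def HasVelocityWithinAt (f : ℝ → M) (s : Set ℝ) (t : ℝ) (v : E) : Prop :=
  HasMFDerivWithinAt 𝓘(ℝ, ℝ) 𝓘(ℝ, E) f s t (ContinuousLinearMap.toSpanSingleton ℝ v)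

namespace HasVelocityWithinAt

variable {f g : ℝ → M} {s u : Set ℝ} {t : ℝ} {v w : E}

theorem continuousWithinAt (h : HasVelocityWithinAt f s t v) : ContinuousWithinAt f s t :=
  HasMFDerivWithinAt.continuousWithinAt h

theorem unique (h : HasVelocityWithinAt f s t v) (h' : HasVelocityWithinAt f s t w)
    (hs : UniqueDiffWithinAt ℝ s t) : v = w := by
  have := UniqueMDiffWithinAt.eq (uniqueMDiffWithinAt_iff_uniqueDiffWithinAt.2 hs) h h'
  have h1 := DFunLike.congr_fun this (1 : ℝ)
  have e : ∀ z : E, ContinuousLinearMap.toSpanSingleton ℝ z (1 : ℝ) = z := fun z => by simp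
  exact (e v).symm.trans (h1.trans (e w))

theorem mono (h : HasVelocityWithinAt f s t v) (hu : u ⊆ s) : HasVelocityWithinAt f u t v :=
  HasMFDerivWithinAt.mono h hu

theorem union (h : HasVelocityWithinAt f s t v) (h' : HasVelocityWithinAt f u t v) :
    HasVelocityWithinAt f (s ∪ u) t v :=
  HasMFDerivWithinAt.union h h'

theorem mono_of_mem_nhdsWithin (h : HasVelocityWithinAt f s t v) (hu : s ∈ 𝓝[u] t) :
    HasVelocityWithinAt f u t v :=
  HasMFDerivWithinAt.mono_of_mem_nhdsWithin h hu

theorem congr_of_eventuallyEq (h : HasVelocityWithinAt f s t v) (hg : g =ᶠ[𝓝[s] t] f)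
    (ht : g t = f t) : HasVelocityWithinAt g s t v :=
  HasMFDerivWithinAt.congr_of_eventuallyEq (f := f) h hg ht

theorem congr (h : HasVelocityWithinAt f s t v) (hg : ∀ r ∈ s, g r = f r) (ht : t ∈ s) :
    HasVelocityWithinAt g s t v :=
  h.congr_of_eventuallyEq (Filter.eventuallyEq_of_mem self_mem_nhdsWithin hg) (hg t ht)

theorem comp {p : M} (h : HasVelocityWithinAt f s t v) (hp : f t = p) {φ : M → N} {φ' : E →L[ℝ] F}
    (hφ : HasMFDerivAt 𝓘(ℝ, E) 𝓘(ℝ, F) φ p φ') :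
    HasVelocityWithinAt (fun r => φ (f r)) s t (φ' v) := by
  subst hp
  refine (HasMFDerivAt.comp_hasMFDerivWithinAt t hφ h).congr_mfderiv ?_
  refine ContinuousLinearMap.ext fun r => ?_
  exact φ'.map_smul r v

theorem comp_mfderiv {p : M} (h : HasVelocityWithinAt f s t v) (hp : f t = p) {φ : M → N}
    (hφ : MDifferentiableAt 𝓘(ℝ, E) 𝓘(ℝ, F) φ p) :
    HasVelocityWithinAt (E := F) (fun r => φ (f r)) s t (mfderiv 𝓘(ℝ, E) 𝓘(ℝ, F) φ p v) :=
  comp (F := F) h hp (φ' := mfderiv 𝓘(ℝ, E) 𝓘(ℝ, F) φ p) hφ.hasMFDerivAt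

theorem comp_zero {p : M} (h : HasVelocityWithinAt f s t (0 : E)) (hp : f t = p) {φ : M → N}
    (hφ : MDifferentiableAt 𝓘(ℝ, E) 𝓘(ℝ, F) φ p) :
    HasVelocityWithinAt (fun r => φ (f r)) s t (0 : F) :=
  map_zero (mfderiv 𝓘(ℝ, E) 𝓘(ℝ, F) φ p) ▸ h.comp_mfderiv hp hφ

end HasVelocityWithinAt

theorem hasVelocityWithinAt_iff_hasDerivWithinAt {f : ℝ → E} {s : Set ℝ} {t : ℝ} {v : E} :
    HasVelocityWithinAt f s t v ↔ HasDerivWithinAt f v s t :=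
  hasMFDerivWithinAt_iff_hasFDerivWithinAt

/-- The base point `p` is kept separate from `f t`, so the chart can be fixed in advance, for
instance at the identity of a group. -/
theorem hasVelocityWithinAt_iff {f : ℝ → M} {s : Set ℝ} {t : ℝ} {p : M} (hp : f t = p) {v : E} :
    HasVelocityWithinAt f s t v ↔ ContinuousWithinAt f s t ∧
      HasDerivWithinAt (fun r => extChartAt 𝓘(ℝ, E) p (f r)) v s t := by
  subst hp
  simp only [HasVelocityWithinAt, HasMFDerivWithinAt, hasDerivWithinAt_iff_hasFDerivWithinAt,
    writtenInExtChartAt, extChartAt_model_space_eq_id, Function.comp_def, PartialEquiv.refl_symm,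
    PartialEquiv.refl_coe, modelWithCornersSelf_coe, range_id, inter_univ, preimage_id, id]
  rfl

theorem hasVelocityWithinAt_const (p : M) (s : Set ℝ) (t : ℝ) :
    HasVelocityWithinAt (fun _ => p) s t (0 : E) := by
  rw [hasVelocityWithinAt_iff rfl]
  exact ⟨continuousWithinAt_const, hasDerivWithinAt_const _ _ _⟩

theorem MDifferentiableWithinAt.hasVelocityWithinAt {f : ℝ → M} {s : Set ℝ} {t : ℝ}
    (h : MDifferentiableWithinAt 𝓘(ℝ, ℝ) 𝓘(ℝ, E) f s t) :
    HasVelocityWithinAt (E := E) f s t (mfderivWithin 𝓘(ℝ, ℝ) 𝓘(ℝ, E) f s t (1 : ℝ)) := by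
  refine h.hasMFDerivWithinAt.congr_mfderiv ?_
  refine ContinuousLinearMap.ext fun (r : ℝ) => ?_
  have h1 := (mfderivWithin 𝓘(ℝ, ℝ) 𝓘(ℝ, E) f s t).map_smul r (1 : ℝ)
  have h2 : r • (1 : ℝ) = r := by simp
  exact (congrArg (mfderivWithin 𝓘(ℝ, ℝ) 𝓘(ℝ, E) f s t) h2).symm.trans h1

/-- Every tangent vector is the velocity of a smooth curve. -/
theorem exists_curve_hasVelocityWithinAt [IsManifold 𝓘(ℝ, E) ∞ M] (p : M) (v : E) :
    ∃ f : ℝ → M, f 0 = p ∧ ContMDiffAt 𝓘(ℝ, ℝ) 𝓘(ℝ, E) ∞ f 0 ∧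
      HasVelocityWithinAt f univ 0 v := by
  have hl : ContDiff ℝ ∞ (fun r : ℝ => extChartAt 𝓘(ℝ, E) p p + r • v) := by fun_prop
  have h0 : extChartAt 𝓘(ℝ, E) p p + (0 : ℝ) • v = extChartAt 𝓘(ℝ, E) p p := by simp
  have hs : ContMDiffAt 𝓘(ℝ, ℝ) 𝓘(ℝ, E) ∞
      (fun r : ℝ => (extChartAt 𝓘(ℝ, E) p).symm (extChartAt 𝓘(ℝ, E) p p + r • v)) 0 := by
    refine ContMDiffAt.comp (0 : ℝ) (g := (extChartAt 𝓘(ℝ, E) p).symm) ?_ hl.contMDiff.contMDiffAt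
    rw [h0]
    exact (contMDiffOn_extChartAt_symm p).contMDiffAt (extChartAt_target_mem_nhds p)
  have hp : (extChartAt 𝓘(ℝ, E) p).symm (extChartAt 𝓘(ℝ, E) p p + (0 : ℝ) • v) = p := by
    rw [h0, extChartAt_to_inv]
  refine ⟨_, hp, hs, ?_⟩
  rw [hasVelocityWithinAt_iff hp]
  refine ⟨hs.continuousAt.continuousWithinAt, ?_⟩
  have hd : HasDerivWithinAt (fun r : ℝ => extChartAt 𝓘(ℝ, E) p p + r • v) v univ 0 := by
    simpa using (((hasDerivAt_id (0 : ℝ)).smul_const v).const_add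
      (extChartAt 𝓘(ℝ, E) p p)).hasDerivWithinAt (s := univ)
  refine hd.congr_of_eventuallyEq ?_ ?_
  · rw [nhdsWithin_univ]
    have : ∀ᶠ r in 𝓝 (0 : ℝ), extChartAt 𝓘(ℝ, E) p p + r • v ∈ (extChartAt 𝓘(ℝ, E) p).target := by
      refine hl.continuous.continuousAt.eventually_mem ?_
      rw [h0]
      exact extChartAt_target_mem_nhds p
    filter_upwards [this] with r hr using PartialEquiv.right_inv _ hr
  · rw [hp, h0]

/-- A curve on a compact interval whose velocity vanishes is constant. -/
theorem eq_of_hasVelocityWithinAt_zero [IsManifold 𝓘(ℝ, E) 1 M] {f : ℝ → M}  {a b : ℝ}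
    (h : ∀ t ∈ Icc a b, HasVelocityWithinAt f (Icc a b) t (0 : E)) :
    ∀ t ∈ Icc a b, ∀ r ∈ Icc a b, f t = f r := by
  -- Local constancy on a connected interval suffices, so no separation axiom on `M` is needed.
  have hloc : IsLocallyConstant (fun t : Icc a b => f t) := by
    rw [IsLocallyConstant.iff_eventually_eq]
    intro t
    have hc : ∀ᶠ r in 𝓝[Icc a b] (t : ℝ), f r ∈ (extChartAt 𝓘(ℝ, E) (f t)).source :=
      (h t t.2).continuousWithinAt.eventually_mem (extChartAt_source_mem_nhds (f t))
    obtain ⟨ε, hε, hball⟩ := Metric.mem_nhdsWithin_iff.1 hc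
    have hmem : ∀ r ∈ Metric.ball (t : ℝ) ε ∩ Icc a b, HasDerivWithinAt
        (fun r => extChartAt 𝓘(ℝ, E) (f t) (f r)) 0 (Metric.ball (t : ℝ) ε ∩ Icc a b) r := by
      intro r hr
      exact hasVelocityWithinAt_iff_hasDerivWithinAt.1 <|
        ((h r hr.2).mono (inter_subset_right (s := Metric.ball (t : ℝ) ε))).comp_zero rfl
          (mdifferentiableAt_extChartAt (by simpa using hball hr))
    have hconv : Convex ℝ (Metric.ball (t : ℝ) ε ∩ Icc a b) :=
      (convex_ball _ _).inter (convex_Icc _ _)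
    have ht : (t : ℝ) ∈ Metric.ball (t : ℝ) ε ∩ Icc a b := ⟨Metric.mem_ball_self hε, t.2⟩
    have hev : ∀ᶠ r : Icc a b in 𝓝 t, (r : ℝ) ∈ Metric.ball (t : ℝ) ε :=
      continuous_subtype_val.continuousAt.eventually_mem (Metric.ball_mem_nhds _ hε)
    filter_upwards [hev] with r hr
    have hr' : (r : ℝ) ∈ Metric.ball (t : ℝ) ε ∩ Icc a b := ⟨hr, r.2⟩
    -- Mean value inequality in the chart with derivative bound `0`; the ball cut with the interval
    -- is convex.
    have hle := hconv.norm_image_sub_le_of_norm_hasDerivWithin_le (C := 0) hmem (by simp) ht hr'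
    have he : extChartAt 𝓘(ℝ, E) (f t) (f r) = extChartAt 𝓘(ℝ, E) (f t) (f t) := by
      rw [zero_mul] at hle
      exact sub_eq_zero.1 (norm_le_zero_iff.1 hle)
    exact (extChartAt 𝓘(ℝ, E) (f t)).injOn (hball hr') (mem_extChartAt_source (f t)) he
  intro t ht r hr
  have : PreconnectedSpace (Icc a b) := isPreconnected_iff_preconnectedSpace.1 isPreconnected_Icc
  exact hloc.apply_eq_of_preconnectedSpace ⟨t, ht⟩ ⟨r, hr⟩

/-- Curves on `[0,1]` regarded as curves on `ℝ`, constant outside of `[0,1]`. -/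
abbrev extend {X : Type*} (c : unitInterval → X) : ℝ → X :=
  c ∘ projIcc (0 : ℝ) 1 zero_le_one

theorem extend_coe {X : Type*} (c : unitInterval → X) (t : unitInterval) : extend c t = c t := by
  simp [extend]

theorem extend_of_mem {X : Type*} (c : unitInterval → X) {t : ℝ} (ht : t ∈ Icc (0 : ℝ) 1) :
    extend c t = c ⟨t, ht⟩ := by
  simp [extend, projIcc_of_mem zero_le_one ht]

theorem contMDiffOn_extend_iff {n : WithTop ℕ∞} {c : unitInterval → M} :
    ContMDiffOn 𝓘(ℝ, ℝ) 𝓘(ℝ, E) n (extend c) (Icc 0 1) ↔ ContMDiff (𝓡∂ 1) 𝓘(ℝ, E) n c :=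
  contMDiffOn_comp_projIcc_iff (x := (0 : ℝ)) (y := 1)

theorem hasVelocityWithinAt_velocity {c : unitInterval → M} {t : unitInterval}
    (hc : MDifferentiableAt (𝓡∂ 1) 𝓘(ℝ, E) c t) :
    HasVelocityWithinAt (E := E) (extend c) (Icc 0 1) t (velocity c t) := by
  have h := (mdifferentiableWithinAt_comp_projIcc_iff (x := (0 : ℝ)) (y := 1) (w := t)).2 hc
  have h1 := MDifferentiableWithinAt.hasVelocityWithinAt h
  have h2 := mfderivWithin_comp_projIcc_one (I := 𝓘(ℝ, E)) (x := (0 : ℝ)) (y := 1) (f := c) (w := t)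
  have h3 : (mfderivWithin 𝓘(ℝ, ℝ) 𝓘(ℝ, E) (extend c) (Icc 0 1) t (1 : ℝ) : E) = velocity c t := h2
  exact h3 ▸ h1

end VelocityCalculus

/-! ### Lie group calculus and logarithmic derivatives -/

section LieGroupCalculus

set_option linter.unusedSectionVars false

variable {E : Type*} [NormedAddCommGroup E] [NormedSpace ℝ E]
  {G : Type*} [TopologicalSpace G] [ChartedSpace E G] [Group G] [LieGroup 𝓘(ℝ, E) ∞ G]
  {s : Set ℝ} {t : ℝ}

theorem isManifold_one_of_lieGroup : IsManifold 𝓘(ℝ, E) 1 G :=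
  have : IsManifold 𝓘(ℝ, E) ∞ G := ContMDiffMul.toIsManifold
  .of_le (n := ∞) (by norm_cast)

theorem mdifferentiableAt_mul_right (g x : G) :
    MDifferentiableAt 𝓘(ℝ, E) 𝓘(ℝ, E) (fun y : G => y * g) x :=
  (contMDiff_mul_right (I := 𝓘(ℝ, E)) (n := ∞) (a := g)).contMDiffAt.mdifferentiableAt (by simp)

theorem mdifferentiableAt_mul_left (g x : G) :
    MDifferentiableAt 𝓘(ℝ, E) 𝓘(ℝ, E) (fun y : G => g * y) x :=
  (contMDiff_mul_left (I := 𝓘(ℝ, E)) (n := ∞) (a := g)).contMDiffAt.mdifferentiableAt (by simp)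

theorem mdifferentiableAt_conj (g x : G) :
    MDifferentiableAt 𝓘(ℝ, E) 𝓘(ℝ, E) (fun y : G => g * y * g⁻¹) x :=
  (((contMDiff_mul_right (I := 𝓘(ℝ, E)) (n := ∞) (a := g⁻¹)).comp
    (contMDiff_mul_left (I := 𝓘(ℝ, E)) (n := ∞) (a := g))).contMDiffAt).mdifferentiableAt
      (by simp)

namespace HasVelocityWithinAt

variable {a b : ℝ → G} {X Y : E}

/-- At the identity both partial derivatives of the multiplication are the identity map. -/
theorem mul_of_eq_one (ha : HasVelocityWithinAt a s t X) (hb : HasVelocityWithinAt b s t Y)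
    (ha1 : a t = 1) (hb1 : b t = 1) : HasVelocityWithinAt (fun r => a r * b r) s t (X + Y) := by
  have hmul : MDifferentiableAt (𝓘(ℝ, E).prod 𝓘(ℝ, E)) 𝓘(ℝ, E) (fun p : G × G => p.1 * p.2)
      (a t, b t) :=
    (contMDiff_mul 𝓘(ℝ, E) ∞).contMDiffAt.mdifferentiableAt (by simp)
  have key := hmul.hasMFDerivAt.comp_hasMFDerivWithinAt t (HasMFDerivWithinAt.prodMk ha hb)
  refine key.congr_mfderiv ?_
  refine ContinuousLinearMap.ext fun (r : ℝ) => ?_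
  refine (mfderiv_prod_eq_add_apply hmul).trans ?_
  have e1 : ∀ u : E, mfderiv 𝓘(ℝ, E) 𝓘(ℝ, E) (fun z : G => z * b t) (a t) u = u := by
    intro u
    have : (fun z : G => z * b t) = id := by funext z; simp [hb1]
    rw [this, mfderiv_id]
    rfl
  have e2 : ∀ u : E, mfderiv 𝓘(ℝ, E) 𝓘(ℝ, E) (fun z : G => a t * z) (b t) u = u := by
    intro u
    have : (fun z : G => a t * z) = id := by funext z; simp [ha1]
    rw [this, mfderiv_id]
    rfl
  refine (congrArg₂ (fun u v : E => u + v) (e1 _) (e2 _)).trans ?_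
  exact (smul_add r X Y).symm

theorem mul_right (ha : HasVelocityWithinAt a s t X) (ha1 : a t = 1) (g : G) :
    HasVelocityWithinAt (E := E) (fun r => a r * g) s t (rightTranslate E g X) :=
  ha.comp_mfderiv ha1 (mdifferentiableAt_mul_right g 1)

theorem conj (ha : HasVelocityWithinAt a s t X) (ha1 : a t = 1) (g : G) :
    HasVelocityWithinAt (E := E) (fun r => g * a r * g⁻¹) s t (Ad E g X) :=
  ha.comp_mfderiv ha1 (mdifferentiableAt_conj g 1)

end HasVelocityWithinAt

theorem exists_curve_one (X : E) :
    ∃ a : ℝ → G, a 0 = 1 ∧ ContMDiffAt 𝓘(ℝ, ℝ) 𝓘(ℝ, E) ∞ a 0 ∧ HasVelocityWithinAt a univ 0 X :=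
  have : IsManifold 𝓘(ℝ, E) ∞ G := ContMDiffMul.toIsManifold
  exists_curve_hasVelocityWithinAt 1 X

/-- Differentiate one test curve with velocity `X`, conjugated in one step and in two steps;
velocities are unique. -/
theorem Ad_mul (g h : G) (X : GroupLieAlgebra 𝓘(ℝ, E) G) : Ad E (g * h) X = Ad E g (Ad E h X) := by
  obtain ⟨a, ha1, -, ha⟩ := exists_curve_one (E := E) (G := G) X
  refine HasVelocityWithinAt.unique (E := E) (ha.conj ha1 (g * h)) ?_ uniqueDiffWithinAt_univ
  refine (HasVelocityWithinAt.conj (E := E) (ha.conj ha1 h) (by simp [ha1]) g).congr (fun r _ => ?_) (mem_univ _)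
  simp [mul_assoc]

theorem Ad_one (X : GroupLieAlgebra 𝓘(ℝ, E) G) : Ad E (1 : G) X = X := by
  obtain ⟨a, ha1, -, ha⟩ := exists_curve_one (E := E) (G := G) X
  refine HasVelocityWithinAt.unique (E := E) (ha.conj ha1 1) ?_ uniqueDiffWithinAt_univ
  exact ha.congr (fun r _ => by simp) (mem_univ _)

theorem Ad_inv_Ad (g : G) (X : GroupLieAlgebra 𝓘(ℝ, E) G) : Ad E g⁻¹ (Ad E g X) = X := by
  rw [← Ad_mul, inv_mul_cancel, Ad_one]

theorem Ad_Ad_inv (g : G) (X : GroupLieAlgebra 𝓘(ℝ, E) G) : Ad E g (Ad E g⁻¹ X) = X := by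
  rw [← Ad_mul, mul_inv_cancel, Ad_one]

theorem HasVelocityWithinAt.inv_of_eq_one {a : ℝ → G} {X : E}
    (ha : HasVelocityWithinAt a s t X) (ha1 : a t = 1) :
    HasVelocityWithinAt (fun r => (a r)⁻¹) s t (-X) := by
  have hinv : MDifferentiableAt 𝓘(ℝ, E) 𝓘(ℝ, E) (fun y : G => y⁻¹) 1 :=
    (contMDiff_inv 𝓘(ℝ, E) ∞).contMDiffAt.mdifferentiableAt (by simp)
  -- Differentiating `b b⁻¹ = 1` gives `X + T(inv) X = 0`.
  have key : (mfderiv 𝓘(ℝ, E) 𝓘(ℝ, E) (fun y : G => y⁻¹) 1 X : E) = -X := by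
    obtain ⟨b, hb1, -, hb⟩ := exists_curve_one (G := G) X
    have h := hb.mul_of_eq_one (hb.comp_mfderiv hb1 hinv) hb1 (by simp [hb1])
    have h' : HasVelocityWithinAt (fun r => b r * (b r)⁻¹) univ 0 (0 : E) :=
      (hasVelocityWithinAt_const (1 : G) univ 0).congr (fun r _ => by simp) (mem_univ _)
    exact eq_neg_of_add_eq_zero_right (h.unique h' uniqueDiffWithinAt_univ)
  exact key ▸ ha.comp_mfderiv ha1 hinv

/-- The curve `g` in the Lie group `G` has right logarithmic derivative `X` at time `t`,
relative to the set of times `s`. -/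
def HasRightLogDerivWithinAt (g : ℝ → G) (s : Set ℝ) (t : ℝ) (X : E) : Prop :=
  HasVelocityWithinAt (fun r => g r * (g t)⁻¹) s t X

theorem HasVelocityWithinAt.exists_hasRightLogDerivWithinAt {g : ℝ → G} {v : E}
    (hg : HasVelocityWithinAt g s t v) : ∃ X : E, HasRightLogDerivWithinAt g s t X :=
  ⟨_, hg.comp_mfderiv rfl (mdifferentiableAt_mul_right (g t)⁻¹ (g t))⟩

/-- Links the logarithmic derivative to the equation in `IsEvolution`: translations by `g t` and its
inverse have mutually inverse derivatives. -/
theorem hasRightLogDerivWithinAt_iff {g : ℝ → G} {X : E} :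
    HasRightLogDerivWithinAt g s t X ↔
      HasVelocityWithinAt (E := E) g s t (rightTranslate E (g t) X) := by
  constructor
  · intro h
    exact (HasVelocityWithinAt.mul_right h (by simp) (g t)).congr_of_eventuallyEq
      (Filter.Eventually.of_forall fun r => by simp) (by simp)
  · intro h
    have hR := mdifferentiableAt_mul_right (E := E) (g t)⁻¹ (g t)
    have key : (mfderiv 𝓘(ℝ, E) 𝓘(ℝ, E) (fun y : G => y * (g t)⁻¹) (g t)
        (rightTranslate E (g t) X) : E) = X := by
      obtain ⟨b, hb1, -, hb⟩ := exists_curve_one (G := G) X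
      have hb2 := HasVelocityWithinAt.comp_mfderiv (E := E) (F := E) (hb.mul_right hb1 (g t))
        (by simp [hb1]) hR
      refine HasVelocityWithinAt.unique (E := E) hb2 ?_ uniqueDiffWithinAt_univ
      exact hb.congr (fun r _ => by simp) (mem_univ _)
    exact key ▸ HasVelocityWithinAt.comp_mfderiv (E := E) (F := E) h rfl hR

namespace HasRightLogDerivWithinAt

variable {g k : ℝ → G} {X Y : E} {u : Set ℝ}

theorem continuousWithinAt (h : HasRightLogDerivWithinAt g s t X) : ContinuousWithinAt g s t :=
  (hasRightLogDerivWithinAt_iff.1 h).continuousWithinAt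

theorem mono (h : HasRightLogDerivWithinAt g s t X) (hu : u ⊆ s) :
    HasRightLogDerivWithinAt g u t X :=
  HasVelocityWithinAt.mono h hu

theorem congr (h : HasRightLogDerivWithinAt g s t X) (hk : ∀ r ∈ s, k r = g r) (ht : t ∈ s) :
    HasRightLogDerivWithinAt k s t X :=
  HasVelocityWithinAt.congr h (fun r hr => by rw [hk r hr, hk t ht]) ht

theorem mul_const (h : HasRightLogDerivWithinAt g s t X) (a : G) :
    HasRightLogDerivWithinAt (fun r => g r * a) s t X := by
  refine HasVelocityWithinAt.congr_of_eventuallyEq h (Filter.Eventually.of_forall fun r => ?_) ?_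
  <;> simp [mul_assoc]

/-- Two curves with right logarithmic derivatives `X` and `Y`: the velocity of `g⁻¹ k`, moved
to the identity. -/
theorem inv_mul (hg : HasRightLogDerivWithinAt g s t X) (hk : HasRightLogDerivWithinAt k s t Y) :
    HasVelocityWithinAt (fun r => (g r * (g t)⁻¹)⁻¹ * (k r * (k t)⁻¹)) s t (-X + Y) :=
  (HasVelocityWithinAt.inv_of_eq_one hg (by simp)).mul_of_eq_one hk (by simp) (by simp)

/-- The two logarithmic derivatives cancel as `-X + X`; translating by the constants `(g t)⁻¹` on
the left and `k t` on the right preserves zero velocity. -/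
theorem inv_mul_eq (hg : HasRightLogDerivWithinAt g s t X)
    (hk : HasRightLogDerivWithinAt k s t X) :
    HasVelocityWithinAt (fun r => (g r)⁻¹ * k r) s t (0 : E) := by
  have h1 := hg.inv_mul hk
  rw [neg_add_cancel] at h1
  have h2 := h1.comp_zero rfl (mdifferentiableAt_mul_right (k t) _)
  have h3 := h2.comp_zero rfl (mdifferentiableAt_mul_left (g t)⁻¹ _)
  refine h3.congr_of_eventuallyEq (Filter.Eventually.of_forall fun r => ?_) ?_
  · simp [mul_assoc]
  · simp

end HasRightLogDerivWithinAt

/-- Curves with the same right logarithmic derivative and a common value coincide. -/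
theorem eq_of_hasRightLogDerivWithinAt {q : ℝ → E} {g k : ℝ → G} {a b : ℝ}
    (hg : ∀ r ∈ Icc a b, HasRightLogDerivWithinAt g (Icc a b) r (q r))
    (hk : ∀ r ∈ Icc a b, HasRightLogDerivWithinAt k (Icc a b) r (q r))
    {t₀ : ℝ} (ht₀ : t₀ ∈ Icc a b) (h0 : g t₀ = k t₀) :
    ∀ r ∈ Icc a b, g r = k r := by
  intro r hr
  have : IsManifold 𝓘(ℝ, E) 1 G := isManifold_one_of_lieGroup
  have h := eq_of_hasVelocityWithinAt_zero (E := E) (f := fun r => (g r)⁻¹ * k r)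
    (fun t ht => (hg t ht).inv_mul_eq (hk t ht)) r hr t₀ ht₀
  have h' : (g r)⁻¹ * k r = 1 := by simpa [h0] using h
  exact (inv_mul_eq_one.1 h')

end LieGroupCalculus

/-! ### Chain rule in a chart -/

section ChartDerivatives

variable {E : Type*} [NormedAddCommGroup E] [NormedSpace ℝ E]
  {F : Type*} [NormedAddCommGroup F] [NormedSpace ℝ F]
  {M : Type*} [TopologicalSpace M] [ChartedSpace E M]

theorem HasVelocityWithinAt.hasDerivWithinAt_comp {f : ℝ → M} {s : Set ℝ} {t : ℝ} {v : E} {p : M}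
    (h : HasVelocityWithinAt f s t v) (hp : f t = p) {ψ : M → F}
    (hψ : DifferentiableAt ℝ (fun y => ψ ((extChartAt 𝓘(ℝ, E) p).symm y)) (extChartAt 𝓘(ℝ, E) p p)) :
    HasDerivWithinAt (fun r => ψ (f r))
      (fderiv ℝ (fun y => ψ ((extChartAt 𝓘(ℝ, E) p).symm y)) (extChartAt 𝓘(ℝ, E) p p) v) s t := by
  have h1 := ((hasVelocityWithinAt_iff hp).1 h).2
  have hp' : extChartAt 𝓘(ℝ, E) p (f t) = extChartAt 𝓘(ℝ, E) p p := by rw [hp]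
  have h2 := (hp' ▸ hψ.hasFDerivAt).comp_hasDerivWithinAt t h1
  rw [hp'] at h2
  refine h2.congr_of_eventuallyEq ?_ ?_
  · have : ∀ᶠ r in 𝓝[s] t, f r ∈ (extChartAt 𝓘(ℝ, E) p).source :=
      h.continuousWithinAt.eventually_mem (hp ▸ extChartAt_source_mem_nhds (f t))
    filter_upwards [this] with r hr
    rw [Function.comp_apply, PartialEquiv.left_inv _ hr]
  · rw [Function.comp_apply, PartialEquiv.left_inv _ (hp ▸ mem_extChartAt_source (f t))]

end ChartDerivatives

/-! ### Smoothness of `Ad` and of logarithmic derivatives -/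

section LieGroupSmoothness

set_option linter.unusedSectionVars false

variable {E : Type*} [NormedAddCommGroup E] [NormedSpace ℝ E]
  {E' : Type*} [NormedAddCommGroup E'] [NormedSpace ℝ E']
  {G : Type*} [TopologicalSpace G] [ChartedSpace E G] [Group G] [LieGroup 𝓘(ℝ, E) ∞ G]

variable (E G) in
/-- The preferred chart of a Lie group at the identity. -/
abbrev chartOne : PartialEquiv G E := extChartAt 𝓘(ℝ, E) (1 : G)

theorem contMDiffAt_chartOne {x : G} (hx : x ∈ (chartOne E G).source) :
    ContMDiffAt 𝓘(ℝ, E) 𝓘(ℝ, E) ∞ (chartOne E G) x :=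
  have : IsManifold 𝓘(ℝ, E) ∞ G := ContMDiffMul.toIsManifold
  contMDiffAt_extChartAt' (by simpa using hx)

theorem contMDiffAt_chartOne_symm {y : E} (hy : y ∈ (chartOne E G).target) :
    ContMDiffAt 𝓘(ℝ, E) 𝓘(ℝ, E) ∞ (chartOne E G).symm y :=
  have : IsManifold 𝓘(ℝ, E) ∞ G := ContMDiffMul.toIsManifold
  (contMDiffOn_extChartAt_symm 1).contMDiffAt ((isOpen_extChartAt_target 1).mem_nhds hy)

theorem chartOne_symm_chartOne_one : (chartOne E G).symm (chartOne E G 1) = 1 :=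
  extChartAt_to_inv 1

theorem chartOne_one_mem_target : chartOne E G 1 ∈ (chartOne E G).target :=
  mem_extChartAt_target 1

/-- The expression `φ (a x * φ⁻¹ y * b x)` in the chart `φ` at the identity depends smoothly on the
parameters, near points where the product lies in the domain of `φ`. -/
theorem contDiffWithinAt_chartOne_mul_mul {s : Set E'} {x₀ : E'} {a b : E' → G} {w : E' → E}
    (ha : ContMDiffWithinAt 𝓘(ℝ, E') 𝓘(ℝ, E) ∞ a s x₀)
    (hb : ContMDiffWithinAt 𝓘(ℝ, E') 𝓘(ℝ, E) ∞ b s x₀)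
    (hw : ContDiffWithinAt ℝ ∞ w s x₀) (hw0 : w x₀ ∈ (chartOne E G).target)
    (h1 : a x₀ * (chartOne E G).symm (w x₀) * b x₀ ∈ (chartOne E G).source) :
    ContDiffWithinAt ℝ ∞ (fun x => chartOne E G (a x * (chartOne E G).symm (w x) * b x)) s x₀ := by
  rw [← contMDiffWithinAt_iff_contDiffWithinAt]
  have hw' := (contMDiffAt_chartOne_symm hw0).comp_contMDiffWithinAt x₀ hw.contMDiffWithinAt
  exact (contMDiffAt_chartOne h1).comp_contMDiffWithinAt x₀ ((ha.mul hw').mul hb)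

/-- Conjugation fixes the identity, so one chart serves for source and target. This makes `Ad` a
derivative in a vector space, depending on a parameter. -/
theorem Ad_eq_fderiv (g : G) : (Ad E g : E →L[ℝ] E) =
    fderiv ℝ (fun y => chartOne E G (g * (chartOne E G).symm y * g⁻¹)) (chartOne E G 1) := by
  refine ContinuousLinearMap.ext fun X => ?_
  obtain ⟨a, ha1, -, ha⟩ := exists_curve_one (E := E) (G := G) X
  have hd : ContDiffWithinAt ℝ ∞ (fun y => chartOne E G (g * (chartOne E G).symm y * g⁻¹)) univ
      (chartOne E G 1) := by
    refine contDiffWithinAt_chartOne_mul_mul contMDiffWithinAt_const contMDiffWithinAt_const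
      contDiffWithinAt_id chartOne_one_mem_target ?_
    simp only [chartOne_symm_chartOne_one]
    simp
  have h1 := ha.hasDerivWithinAt_comp ha1
    (ψ := fun y => chartOne E G (g * y * g⁻¹)) ((contDiffWithinAt_univ.1 hd).differentiableAt (by simp))
  have h2 := ((hasVelocityWithinAt_iff (p := (1 : G)) (by simp [ha1])).1 (ha.conj ha1 g)).2
  exact (hasDerivWithinAt_univ.1 h2).unique (hasDerivWithinAt_univ.1 h1)

/-- `Ad` is smooth along smooth curves. -/
theorem contDiffWithinAt_Ad {s : Set ℝ} {t₀ : ℝ} {g : ℝ → G}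
    (hg : ContMDiffWithinAt 𝓘(ℝ, ℝ) 𝓘(ℝ, E) ∞ g s t₀) (ht₀ : t₀ ∈ s) :
    ContDiffWithinAt ℝ ∞ (F := E →L[ℝ] E) (fun t => Ad E (g t)) s t₀ := by
  simp only [Ad_eq_fderiv, ← fderivWithin_univ]
  have hfst : ContMDiffWithinAt 𝓘(ℝ, ℝ × E) 𝓘(ℝ, E) ∞ (fun x : ℝ × E => g x.1) (s ×ˢ univ)
      (t₀, chartOne E G 1) :=
    ContMDiffWithinAt.comp (I' := 𝓘(ℝ, ℝ)) (t := s) (t₀, chartOne E G 1) hg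
      contDiffWithinAt_fst.contMDiffWithinAt (fun x hx => hx.1)
  refine ContDiffWithinAt.fderivWithin (n := ∞) (g := fun _ => chartOne E G 1)
    (f := fun t y => chartOne E G (g t * (chartOne E G).symm y * (g t)⁻¹)) ?_
    contDiffWithinAt_const uniqueDiffOn_univ (by simp) ht₀ (by simp)
  refine contDiffWithinAt_chartOne_mul_mul (w := Prod.snd) hfst hfst.inv
    contDiffWithinAt_snd chartOne_one_mem_target ?_
  rw [chartOne_symm_chartOne_one]
  simp

/-- A smooth curve has a smooth right logarithmic derivative. -/
theorem exists_contDiffOn_hasRightLogDerivWithinAt {s : Set ℝ} (hs : UniqueDiffOn ℝ s) {g : ℝ → G}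
    (hg : ContMDiffOn 𝓘(ℝ, ℝ) 𝓘(ℝ, E) ∞ g s) :
    ∃ X : ℝ → E, ContDiffOn ℝ ∞ X s ∧ ∀ t ∈ s, HasRightLogDerivWithinAt g s t (X t) := by
  -- The logarithmic derivative is the `u`-derivative at `u = t` of this two-variable function; near
  -- the diagonal its group argument stays in the chart.
  have hK : ∀ t ∈ s, ContDiffWithinAt ℝ ∞ (Function.uncurry
      (fun t u => chartOne E G (g u * (g t)⁻¹))) (s ×ˢ s) (t, t) := by
    intro t ht
    have h1 : ContMDiffWithinAt 𝓘(ℝ, ℝ × ℝ) 𝓘(ℝ, E) ∞ (fun x : ℝ × ℝ => g x.1) (s ×ˢ s) (t, t) :=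
      ContMDiffWithinAt.comp (I' := 𝓘(ℝ, ℝ)) (t := s) (t, t) (hg t ht)
        contDiffWithinAt_fst.contMDiffWithinAt (fun x hx => hx.1)
    have h2 : ContMDiffWithinAt 𝓘(ℝ, ℝ × ℝ) 𝓘(ℝ, E) ∞ (fun x : ℝ × ℝ => g x.2) (s ×ˢ s) (t, t) :=
      ContMDiffWithinAt.comp (I' := 𝓘(ℝ, ℝ)) (t := s) (t, t) (hg t ht)
        contDiffWithinAt_snd.contMDiffWithinAt (fun x hx => hx.2)
    rw [← contMDiffWithinAt_iff_contDiffWithinAt]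
    exact (contMDiffAt_chartOne (by simp)).comp_contMDiffWithinAt (t, t) (h2.mul h1.inv)
  refine ⟨fun t => fderivWithin ℝ (fun u => chartOne E G (g u * (g t)⁻¹)) s t 1,
    fun t ht => ?_, fun t ht => ?_⟩
  · exact ContDiffWithinAt.fderivWithin_apply (n := ∞) (g := id) (hK t ht) contDiffWithinAt_id
      contDiffWithinAt_const hs (by simp) ht subset_rfl
  · have hd : DifferentiableWithinAt ℝ (fun u => chartOne E G (g u * (g t)⁻¹)) s t := by
      have h := (hK t ht).comp t (t := s ×ˢ s) (s := s) (f := fun u => (t, u))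
        (contDiffWithinAt_const.prodMk contDiffWithinAt_id) (fun u hu => ⟨ht, hu⟩)
      exact h.differentiableWithinAt (by simp)
    refine (hasVelocityWithinAt_iff (p := (1 : G)) (by simp)).2 ⟨?_, ?_⟩
    · exact ((hg t ht).mul contMDiffWithinAt_const).continuousWithinAt
    · exact hd.hasFDerivWithinAt.hasDerivWithinAt

variable (E G) in
/-- The right-invariant vector fields of a Lie group in the chart `φ` at the identity: the value
at `z` of the field generated by `X` is `rightInvariantField z X`. -/
def rightInvariantField (z : E) : E →L[ℝ] E :=
  fderiv ℝ (fun y => chartOne E G ((chartOne E G).symm y * (chartOne E G).symm z)) (chartOne E G 1)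

theorem contDiffAt_chartOne_mul {z : E} (hz : z ∈ (chartOne E G).target) : ContDiffAt ℝ ∞
    (fun x : E × E => chartOne E G ((chartOne E G).symm x.2 * (chartOne E G).symm x.1))
      (z, chartOne E G 1) := by
  have h := contDiffWithinAt_chartOne_mul_mul (s := univ) (x₀ := (z, chartOne E G 1))
    (w := fun x : E × E => x.2) (a := fun _ => (1 : G)) (b := fun x => (chartOne E G).symm x.1)
    contMDiffWithinAt_const
    (ContMDiffAt.comp_contMDiffWithinAt (I' := 𝓘(ℝ, E)) (z, chartOne E G 1)
      (contMDiffAt_chartOne_symm hz) contDiffWithinAt_fst.contMDiffWithinAt)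
    contDiffWithinAt_snd chartOne_one_mem_target (by
      rw [chartOne_symm_chartOne_one]
      simpa using PartialEquiv.map_target _ hz)
  simpa using contDiffWithinAt_univ.1 h

theorem contDiffAt_rightInvariantField {z : E} (hz : z ∈ (chartOne E G).target) :
    ContDiffAt ℝ ∞ (rightInvariantField E G) z :=
  ContDiffAt.fderiv (n := ∞) (g := fun _ => chartOne E G 1)
    (f := fun z y => chartOne E G ((chartOne E G).symm y * (chartOne E G).symm z))
    (contDiffAt_chartOne_mul hz) contDiffAt_const (by simp)

theorem differentiableAt_chartOne_mul {z : E} (hz : z ∈ (chartOne E G).target) : DifferentiableAt ℝ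
    (fun y => chartOne E G ((chartOne E G).symm y * (chartOne E G).symm z)) (chartOne E G 1) :=
  ((contDiffAt_chartOne_mul hz).comp (chartOne E G 1) (f := fun y => (z, y))
    (contDiffAt_const.prodMk contDiffAt_id)).differentiableAt (by simp)

/-- The equation for the right logarithmic derivative, in the chart at the identity. -/
theorem HasRightLogDerivWithinAt.hasDerivWithinAt_chartOne {x : ℝ → G} {s : Set ℝ} {t : ℝ} {X : E}
    (h : HasRightLogDerivWithinAt x s t X) (hx : x t ∈ (chartOne E G).source) :
    HasDerivWithinAt (fun r => chartOne E G (x r))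
      (rightInvariantField E G (chartOne E G (x t)) X) s t := by
  have hz := PartialEquiv.map_source _ hx
  have hl := PartialEquiv.left_inv _ hx
  have h1 := HasVelocityWithinAt.hasDerivWithinAt_comp h (p := 1) (by simp)
    (ψ := fun y => chartOne E G (y * (chartOne E G).symm (chartOne E G (x t))))
    (differentiableAt_chartOne_mul hz)
  simp only [hl, inv_mul_cancel_right] at h1
  rw [rightInvariantField, hl]
  exact h1

/-- Converse of the previous lemma. The test curve `a r * p` has logarithmic derivative `X`, hence
the same velocity in the chart as `y`; transporting both back by the inverse chart identifies the
result as `X`. -/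
theorem hasRightLogDerivWithinAt_of_chartOne {y : ℝ → E} {s : Set ℝ} {t : ℝ} {X : E}
    (hy : y t ∈ (chartOne E G).target)
    (h : HasDerivWithinAt y (rightInvariantField E G (y t) X) s t) :
    HasRightLogDerivWithinAt (fun r => (chartOne E G).symm (y r)) s t X := by
  set p : G := (chartOne E G).symm (y t) with hp
  have hps : p ∈ (chartOne E G).source := PartialEquiv.map_target _ hy
  have hpy : chartOne E G p = y t := PartialEquiv.right_inv _ hy
  obtain ⟨a, ha1, has, ha⟩ := exists_curve_one (E := E) (G := G) X
  have hap : HasRightLogDerivWithinAt (fun r => a r * p) univ 0 X :=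
    ha.congr (fun r _ => by simp [ha1]) (mem_univ _)
  have h1 := hap.hasDerivWithinAt_chartOne (by simpa [ha1] using hps)
  have hχ : MDifferentiableAt 𝓘(ℝ, E) 𝓘(ℝ, E) (fun w => (chartOne E G).symm w * p⁻¹) (y t) :=
    ((contMDiffAt_chartOne_symm hy).mul contMDiffAt_const).mdifferentiableAt (by simp)
  have h2 := (hasVelocityWithinAt_iff_hasDerivWithinAt.2 h1).comp_mfderiv (p := y t)
    (by rw [ha1, one_mul, hpy]) hχ
  have h3 := (hasVelocityWithinAt_iff_hasDerivWithinAt.2 h).comp_mfderiv rfl hχ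
  have e0 : chartOne E G (a 0 * p) = y t := by rw [ha1, one_mul, hpy]
  rw [e0] at h2
  have key := HasVelocityWithinAt.unique ha (h2.congr_of_eventuallyEq ?_ ?_)
    uniqueDiffWithinAt_univ
  · exact key ▸ h3
  · have hc : ContinuousWithinAt (fun r => a r * p) univ 0 := hap.continuousWithinAt
    have : ∀ᶠ r in 𝓝[univ] (0 : ℝ), a r * p ∈ (chartOne E G).source :=
      hc.eventually_mem ((isOpen_extChartAt_source (1 : G)).mem_nhds (by simpa [ha1] using hps))
    filter_upwards [this] with r hr
    rw [PartialEquiv.left_inv _ hr]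
    simp
  · rw [PartialEquiv.left_inv _ (by simpa [ha1] using hps)]
    simp

end LieGroupSmoothness

/-! ### Existence, uniqueness and regularity of evolutions -/

section Evolution

variable {E : Type*} [NormedAddCommGroup E] [NormedSpace ℝ E]
  {G : Type*} [TopologicalSpace G] [ChartedSpace E G] [Group G] [LieGroup 𝓘(ℝ, E) ∞ G]

/-- Local existence of curves with given right logarithmic derivative. -/
theorem exists_hasRightLogDerivWithinAt_nhds [CompleteSpace E] {q : ℝ → E} (hq : Continuous q)
    (t₀ : ℝ) : ∃ ε > 0, ∃ x : ℝ → G, ∀ t ∈ Ioo (t₀ - ε) (t₀ + ε),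
      HasRightLogDerivWithinAt x (Ioo (t₀ - ε) (t₀ + ε)) t (q t) := by
  set V := rightInvariantField E G
  set p := chartOne E G 1
  have hV : ContDiffAt ℝ ∞ V p := contDiffAt_rightInvariantField chartOne_one_mem_target
  obtain ⟨K, s, hs, hK⟩ := (hV.of_le (m := 1) (by norm_cast)).exists_lipschitzOnWith
  have hb : ∀ᶠ z in 𝓝 p, ‖V z‖ < ‖V p‖ + 1 :=
    hV.continuousAt.norm.eventually_lt_const (lt_add_one _)
  obtain ⟨a, ha, has⟩ := Metric.nhds_basis_closedBall.mem_iff.1 (Filter.inter_mem hs hb)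
  obtain ⟨Q, hQ⟩ := (isCompact_Icc (a := t₀ - 1) (b := t₀ + 1)).exists_bound_of_continuousOn
    hq.continuousOn
  have hQ0 : 0 ≤ Q := (norm_nonneg _).trans (hQ t₀ (by constructor <;> linarith))
  -- Bound on the speed of solutions in the closed ball of radius `a`. Time at most `a / (L + 1)`
  -- keeps them inside; the `+ 1` avoids division by zero.
  set L : ℝ := (‖V p‖ + 1) * Q with hL
  have hL0 : 0 ≤ L := by positivity
  set δ : ℝ := min 1 (a / (L + 1)) with hδ
  have hδ0 : 0 < δ := by positivity
  have hδ1 : δ ≤ 1 := min_le_left _ _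
  have hLδ : L * δ ≤ a := by
    have h1 : δ * (L + 1) ≤ a := by
      rw [← le_div_iff₀ (by positivity)]
      exact min_le_right _ _
    nlinarith
  have hsub : Icc (t₀ - δ) (t₀ + δ) ⊆ Icc (t₀ - 1) (t₀ + 1) :=
    Icc_subset_Icc (by linarith) (by linarith)
  have hPL : IsPicardLindelof (fun t z => V z (q t)) (tmin := t₀ - δ) (tmax := t₀ + δ)
      ⟨t₀, by constructor <;> linarith⟩ p ⟨a, ha.le⟩ 0 ⟨L, hL0⟩ (K * ⟨Q, hQ0⟩) := by
    refine ⟨fun t ht => ?_, fun z hz => ?_, fun t ht z hz => ?_, ?_⟩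
    · refine LipschitzOnWith.of_dist_le_mul fun z hz w hw => ?_
      rw [dist_eq_norm, ← sub_apply]
      calc ‖(V z - V w) (q t)‖ ≤ ‖V z - V w‖ * ‖q t‖ := ContinuousLinearMap.le_opNorm _ _
        _ ≤ (K * dist z w) * Q := by
          refine mul_le_mul ?_ (hQ t (hsub ht)) (norm_nonneg _) (by positivity)
          rw [← dist_eq_norm]
          exact hK.dist_le_mul z (has hz).1 w (has hw).1
        _ = (K * Q) * dist z w := by ring
    · exact ((V z).continuous.comp hq).continuousOn
    · exact ((V z).le_opNorm _).trans
        (mul_le_mul (has hz).2.le (hQ t (hsub ht)) (norm_nonneg _) (by positivity))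
    · have hmax : max (t₀ + δ - t₀) (t₀ - (t₀ - δ)) = δ := by simp
      change L * max (t₀ + δ - t₀) (t₀ - (t₀ - δ)) ≤ a - 0
      rwa [hmax, sub_zero]
  obtain ⟨y, hy0, hy⟩ := hPL.exists_eq_forall_mem_Icc_hasDerivWithinAt₀
  have hyc : ContinuousAt y t₀ :=
    (hy t₀ (by constructor <;> linarith)).continuousWithinAt.continuousAt
      (Icc_mem_nhds (by linarith) (by linarith))
  have hyt : ∀ᶠ t in 𝓝 t₀, y t ∈ (chartOne E G).target :=
    hyc.eventually_mem (by
      have : y t₀ = p := hy0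
      rw [this]
      exact (isOpen_extChartAt_target (1 : G)).mem_nhds chartOne_one_mem_target)
  obtain ⟨η, hη, hηt⟩ := Metric.eventually_nhds_iff_ball.1 hyt
  -- Shrinking to `η` keeps `y` in the chart target, so that it can be carried back to `G`.
  refine ⟨min δ η, by positivity, fun t => (chartOne E G).symm (y t), fun t ht => ?_⟩
  have hI : Ioo (t₀ - min δ η) (t₀ + min δ η) ⊆ Icc (t₀ - δ) (t₀ + δ) := fun r hr =>
    ⟨by linarith [hr.1, min_le_left δ η], by linarith [hr.2, min_le_left δ η]⟩
  refine hasRightLogDerivWithinAt_of_chartOne (hηt t ?_) ((hy t (hI ht)).mono hI)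
  rw [Real.ball_eq_Ioo]
  exact ⟨by linarith [ht.1, min_le_right δ η], by linarith [ht.2, min_le_right δ η]⟩

/-- Concatenation of curves with given right logarithmic derivative. -/
theorem exists_hasRightLogDerivWithinAt_concat {q : ℝ → E} {a b c : ℝ} (hab : a ≤ b) (hbc : b ≤ c)
    {g x : ℝ → G} (hg : ∀ t ∈ Icc a b, HasRightLogDerivWithinAt g (Icc a b) t (q t))
    (hx : ∀ t ∈ Icc b c, HasRightLogDerivWithinAt x (Icc b c) t (q t)) :
    ∃ k : ℝ → G, k a = g a ∧ ∀ t ∈ Icc a c, HasRightLogDerivWithinAt k (Icc a c) t (q t) := by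
  classical
  -- Right multiplication by `(x b)⁻¹ * g b` matches the values at `b` without changing the
  -- logarithmic derivative.
  set k : ℝ → G := fun r => if r ≤ b then g r else x r * ((x b)⁻¹ * g b) with hk
  have hkl : ∀ r ∈ Icc a b, k r = g r := fun r hr => by simp [hk, hr.2]
  have hkr : ∀ r ∈ Icc b c, k r = x r * ((x b)⁻¹ * g b) := by
    intro r hr
    rcases hr.1.eq_or_lt with rfl | h
    · simp [hk]
    · simp [hk, not_le.2 h]
  have h1 : ∀ t ∈ Icc a b, HasRightLogDerivWithinAt k (Icc a b) t (q t) :=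
    fun t ht => (hg t ht).congr hkl ht
  have h2 : ∀ t ∈ Icc b c, HasRightLogDerivWithinAt k (Icc b c) t (q t) :=
    fun t ht => ((hx t ht).mul_const _).congr hkr ht
  refine ⟨k, hkl a (left_mem_Icc.2 hab), fun t ht => ?_⟩
  rcases lt_trichotomy t b with h | rfl | h
  · refine HasVelocityWithinAt.mono_of_mem_nhdsWithin (h1 t ⟨ht.1, h.le⟩) ?_
    filter_upwards [self_mem_nhdsWithin, mem_nhdsWithin_of_mem_nhds (Iio_mem_nhds h)] with r hr hr'
    exact ⟨hr.1, le_of_lt hr'⟩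
  · rw [← Icc_union_Icc_eq_Icc hab hbc]
    exact HasVelocityWithinAt.union (h1 t (right_mem_Icc.2 hab)) (h2 t (left_mem_Icc.2 hbc))
  · refine HasVelocityWithinAt.mono_of_mem_nhdsWithin (h2 t ⟨h.le, ht.2⟩) ?_
    filter_upwards [self_mem_nhdsWithin, mem_nhdsWithin_of_mem_nhds (Ioi_mem_nhds h)] with r hr hr'
    exact ⟨le_of_lt hr', hr.2⟩

/-- Global existence of curves with given right logarithmic derivative. -/
theorem exists_hasRightLogDerivWithinAt [CompleteSpace E] {q : ℝ → E} (hq : Continuous q) :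
    ∃ g : ℝ → G, g 0 = 1 ∧ ∀ t ∈ Icc (0 : ℝ) 1, HasRightLogDerivWithinAt g (Icc 0 1) t (q t) := by
  choose ε hε x hx using exists_hasRightLogDerivWithinAt_nhds (G := G) hq
  obtain ⟨τ, hτ0, hτm, ⟨n, hn⟩, hτ⟩ := exists_monotone_Icc_subset_open_cover_unitInterval
    (c := fun i : unitInterval => {t : unitInterval | (t : ℝ) ∈ Ioo ((i : ℝ) - ε i) (i + ε i)})
    (fun i => isOpen_Ioo.preimage continuous_subtype_val)
    (fun t _ => mem_iUnion.2 ⟨t, by simp [hε]⟩)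
  have key : ∀ m, ∃ g : ℝ → G, g 0 = 1 ∧
      ∀ t ∈ Icc (0 : ℝ) (τ m), HasRightLogDerivWithinAt g (Icc 0 (τ m)) t (q t) := by
    intro m
    induction m with
    | zero =>
      refine ⟨fun _ => 1, rfl, fun t ht => ?_⟩
      obtain rfl : t = 0 := by simpa [hτ0] using ht
      -- The induction starts on the degenerate interval `{0}`, where the local solution is
      -- normalised to take the value `1`.
      have h : HasRightLogDerivWithinAt (x 0) {(0 : ℝ)} 0 (q 0) :=
        (hx 0 0 (by simp [hε])).mono (by simp [hε])
      rw [hτ0]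
      simp only [Icc.coe_zero, Icc_self]
      exact (h.mul_const (x 0 0)⁻¹).congr (fun r hr => by simp_all) rfl
    | succ m ih =>
      obtain ⟨g, hg0, hg⟩ := ih
      obtain ⟨i, hi⟩ := hτ m
      have hsub : Icc (τ m : ℝ) (τ (m + 1)) ⊆ Ioo ((i : ℝ) - ε i) (i + ε i) := fun r hr =>
        hi (a := ⟨r, (τ m).2.1.trans hr.1, hr.2.trans (τ (m + 1)).2.2⟩) ⟨hr.1, hr.2⟩
      obtain ⟨k, hk0, hk⟩ := exists_hasRightLogDerivWithinAt_concat (τ m).2.1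
        (hτm (Nat.le_succ m)) hg (fun t ht => (hx i t (hsub ht)).mono hsub)
      exact ⟨k, hk0.trans hg0, hk⟩
  simpa [hn n le_rfl] using key n

/-- Curves with smooth right logarithmic derivative are smooth. -/
theorem contMDiffOn_of_hasRightLogDerivWithinAt [CompleteSpace E] {q : ℝ → E} {g : ℝ → G} {a b : ℝ}
    (hq : ContDiffOn ℝ ∞ q (Icc a b))
    (hg : ∀ t ∈ Icc a b, HasRightLogDerivWithinAt g (Icc a b) t (q t)) :
    ContMDiffOn 𝓘(ℝ, ℝ) 𝓘(ℝ, E) ∞ g (Icc a b) := by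
  intro t₀ ht₀
  -- Translating `g t₀` to the identity brings the curve near `t₀` into the chart at the identity.
  have hx : ∀ t ∈ Icc a b, HasRightLogDerivWithinAt (fun r => g r * (g t₀)⁻¹) (Icc a b) t (q t) :=
    fun t ht => (hg t ht).mul_const _
  have hev : ∀ᶠ t in 𝓝[Icc a b] t₀, g t * (g t₀)⁻¹ ∈ (chartOne E G).source :=
    (hx t₀ ht₀).continuousWithinAt.eventually_mem (by
      simpa using extChartAt_source_mem_nhds (I := 𝓘(ℝ, E)) (1 : G))
  obtain ⟨ε, hε, hball⟩ := Metric.mem_nhdsWithin_iff.1 hev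
  set J := Icc (max a (t₀ - ε / 2)) (min b (t₀ + ε / 2)) with hJ
  have hJI : J ⊆ Icc a b := Icc_subset_Icc (le_max_left _ _) (min_le_left _ _)
  have hJb : J ⊆ Metric.ball t₀ ε := by
    intro r hr
    rw [Real.ball_eq_Ioo]
    exact ⟨by linarith [hr.1, le_max_right a (t₀ - ε / 2)],
      by linarith [hr.2, min_le_right b (t₀ + ε / 2)]⟩
  have hsrc : ∀ t ∈ J, g t * (g t₀)⁻¹ ∈ (chartOne E G).source := fun t ht => hball ⟨hJb ht, hJI ht⟩
  have hJn : J ∈ 𝓝[Icc a b] t₀ := by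
    filter_upwards [self_mem_nhdsWithin, mem_nhdsWithin_of_mem_nhds
      (Icc_mem_nhds (show t₀ - ε / 2 < t₀ by linarith) (show t₀ < t₀ + ε / 2 by linarith))]
      with r hr hr'
    exact ⟨max_le hr.1 hr'.1, le_min hr.2 hr'.2⟩
  have hf : ContDiffOn ℝ ∞ (Function.uncurry fun (t : ℝ) (z : E) => rightInvariantField E G z (q t))
      (J ×ˢ (chartOne E G).target) := by
    have h1 : ContDiffOn ℝ ∞ (fun p : ℝ × E => rightInvariantField E G p.2)
        (J ×ˢ (chartOne E G).target) := fun p hp =>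
      (contDiffAt_rightInvariantField hp.2).comp_contDiffWithinAt p contDiffWithinAt_snd
    exact h1.clm_apply ((hq.mono hJI).comp contDiffOn_fst fun p hp => hp.1)
  -- A solution of an ODE with smooth right-hand side is smooth.
  have hy := ODE.contDiffOn_enat_Icc_of_hasDerivWithinAt (n := ⊤) (u := (chartOne E G).target)
    (α := fun t => chartOne E G (g t * (g t₀)⁻¹)) hf
    (fun t ht => ((hx t (hJI ht)).hasDerivWithinAt_chartOne (hsrc t ht)).mono hJI)
    (fun t ht => PartialEquiv.map_source _ (hsrc t ht))
  have ht₀J : t₀ ∈ J := mem_of_mem_nhdsWithin ht₀ hJn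
  have hs : ContMDiffWithinAt 𝓘(ℝ, ℝ) 𝓘(ℝ, E) ∞
      (fun t => (chartOne E G).symm (chartOne E G (g t * (g t₀)⁻¹)) * g t₀) J t₀ :=
    ((contMDiffAt_chartOne_symm (PartialEquiv.map_source _ (hsrc t₀ ht₀J))).comp_contMDiffWithinAt
      t₀ (hy t₀ ht₀J).contMDiffWithinAt).mul contMDiffWithinAt_const
  have hs' : ContMDiffWithinAt 𝓘(ℝ, ℝ) 𝓘(ℝ, E) ∞ g J t₀ :=
    hs.congr (fun t ht => by rw [PartialEquiv.left_inv _ (hsrc t ht), inv_mul_cancel_right])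
      (by rw [PartialEquiv.left_inv _ (hsrc t₀ ht₀J), inv_mul_cancel_right])
  exact hs'.mono_of_mem_nhdsWithin hJn

variable {q : unitInterval → GroupLieAlgebra 𝓘(ℝ, E) G} {g : unitInterval → G}

theorem IsEvolution.hasRightLogDerivWithinAt (h : IsEvolution E q g) :
    ∀ t ∈ Icc (0 : ℝ) 1, HasRightLogDerivWithinAt (E := E) (extend g) (Icc 0 1) t (extend q t) := by
  intro t ht
  lift t to unitInterval using ht
  have h1 := hasVelocityWithinAt_velocity (E := E) (t := t) ((h.smooth t).mdifferentiableAt (by simp))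
  rw [h.deriv_eq] at h1
  rw [hasRightLogDerivWithinAt_iff, extend_coe]
  exact (congrArg (fun X => HasVelocityWithinAt (E := E) (extend g) (Icc 0 1) t
    (rightTranslate E (g t) X)) (extend_coe q t)).mpr h1

theorem isEvolution_of_hasRightLogDerivWithinAt [CompleteSpace E] {k : ℝ → G} (hk0 : k 0 = 1)
    (hq : q ∈ smoothLieCurves E G)
    (h : ∀ t ∈ Icc (0 : ℝ) 1, HasRightLogDerivWithinAt (E := E) k (Icc 0 1) t (extend q t)) :
    IsEvolution E q (fun t => k t) := by
  have hq' : ContDiffOn ℝ ∞ (F := E) (extend q) (Icc 0 1) :=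
    contMDiffOn_iff_contDiffOn.1 (contMDiffOn_extend_iff (M := E).2 hq)
  have hk := contMDiffOn_of_hasRightLogDerivWithinAt (E := E) hq' h
  have hext : ∀ t ∈ Icc (0 : ℝ) 1, extend (fun t : unitInterval => k t) t = k t :=
    fun t ht => extend_of_mem _ ht
  have hs : ContMDiff (𝓡∂ 1) 𝓘(ℝ, E) ∞ (fun t : unitInterval => k t) :=
    contMDiffOn_extend_iff.1 (hk.congr hext)
  refine ⟨hs, hk0, fun t => ?_⟩
  have h1 := hasVelocityWithinAt_velocity (E := E) (t := t) ((hs t).mdifferentiableAt (by simp))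
  have h2 := (h t t.2).congr hext t.2
  rw [hasRightLogDerivWithinAt_iff] at h2
  have h3 := h1.unique h2 (uniqueDiffOn_Icc zero_lt_one t t.2)
  have h4 : (rightTranslate E (extend (fun t : unitInterval => k t) t) (extend q t) : E) =
      rightTranslate E (k t) (q t) :=
    congrArg₂ (fun x (X : E) => (rightTranslate E x X : E)) (hext t t.2) (extend_coe q t)
  exact h3.trans h4

theorem existsUnique_isEvolution [CompleteSpace E] (hq : q ∈ smoothLieCurves E G) :
    ∃! g : unitInterval → G, IsEvolution E q g := by
  have hqc : Continuous (X := ℝ) (Y := E) (extend q) :=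
    (ContMDiff.continuous (M' := E) hq).comp continuous_projIcc
  obtain ⟨k, hk0, hk⟩ := exists_hasRightLogDerivWithinAt (E := E) (G := G) hqc
  refine ⟨_, isEvolution_of_hasRightLogDerivWithinAt hk0 hq hk, fun g hg => funext fun t => ?_⟩
  have h := eq_of_hasRightLogDerivWithinAt (E := E) hg.hasRightLogDerivWithinAt hk
    (left_mem_Icc.2 zero_le_one) ?_ t t.2
  · simpa using h
  · rw [hk0, ← hg.start]
    simp [extend]

end Evolution

/-! ### Local sections of submersions -/

section Sections

variable {E : Type*} [NormedAddCommGroup E] [NormedSpace ℝ E]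
  {F : Type*} [NormedAddCommGroup F] [NormedSpace ℝ F]
  {M : Type*} [TopologicalSpace M] [ChartedSpace E M]
  {N : Type*} [TopologicalSpace N] [ChartedSpace F N]

/-- A submersion has smooth local sections through every point. -/
theorem _root_.Manifold.IsSubmersionAt.exists_section {f : M → N} {x : M}
    (h : Manifold.IsSubmersionAt 𝓘(ℝ, E) 𝓘(ℝ, F) ∞ f x) :
    ∃ (σ : N → M) (U : Set N), IsOpen U ∧ f x ∈ U ∧ ContMDiffOn 𝓘(ℝ, F) 𝓘(ℝ, E) ∞ σ U ∧
      σ (f x) = x ∧ ∀ y ∈ U, f (σ y) = y := by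
  set φ := h.domChart
  set ψ := h.codChart
  set e := h.equiv
  have hw : ∀ z ∈ φ.target, ψ (f (φ.symm z)) = (e z).1 := by
    intro z hz
    have := h.writtenInCharts (by simpa using hz)
    simpa using this
  have hx : x ∈ φ.source := h.mem_domChart_source
  -- In adapted charts `f` is a product projection; the section freezes the second component at its
  -- value at `x`.
  set j : N → E := fun y => e.symm (ψ y, (e (φ x)).2) with hj
  have hjx : j (f x) = φ x := by
    have h1 := hw (φ x) (φ.map_source hx)
    rw [φ.left_inv hx] at h1
    rw [hj]
    simp only [h1]
    exact e.symm_apply_apply _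
  have hψ : ContMDiffOn 𝓘(ℝ, F) 𝓘(ℝ, F) ∞ ψ ψ.source :=
    contMDiffOn_of_mem_maximalAtlas h.codChart_mem_maximalAtlas
  have hjs : ContMDiffOn 𝓘(ℝ, F) 𝓘(ℝ, E) ∞ j ψ.source := by
    have h1 : ContDiff ℝ ∞ (fun w : F => e.symm (w, (e (φ x)).2)) :=
      e.symm.contDiff.comp (contDiff_id.prodMk contDiff_const)
    exact h1.contMDiff.comp_contMDiffOn hψ
  refine ⟨fun y => φ.symm (j y), ψ.source ∩ j ⁻¹' φ.target,
    hjs.continuousOn.isOpen_inter_preimage ψ.open_source φ.open_target,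
    ⟨h.mem_codChart_source, by rw [mem_preimage, hjx]; exact φ.map_source hx⟩,
    (contMDiffOn_symm_of_mem_maximalAtlas h.domChart_mem_maximalAtlas).comp
      (hjs.mono inter_subset_left) (fun y hy => hy.2), ?_, fun y hy => ?_⟩
  · simp only [hjx]
    exact φ.left_inv hx
  · refine ψ.injOn (h.source_subset_preimage_source (φ.map_target hy.2)) hy.1 ?_
    rw [hw _ hy.2]
    simp [hj]

end Sections

/-! ### Inverting a surjection on a complement of its kernel -/

section Projection

/-- `ContinuousLinearMap.inverse` is a true inverse only on isomorphisms and `0` otherwise. Here the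
restriction to the complement is bijective, and finite dimension makes its inverse continuous. -/
theorem apply_inverse_comp_subtypeL {E : Type*} [NormedAddCommGroup E] [NormedSpace ℝ E]
    [FiniteDimensional ℝ E] {F : Type*} [NormedAddCommGroup F] [NormedSpace ℝ F] (T : E →L[ℝ] F)
    (hT : Function.Surjective T) (m : Submodule ℝ E) (hm : IsCompl T.ker m) :
    (∀ w, T (m.subtypeL ((T ∘L m.subtypeL).inverse w)) = w) ∧
      ∀ X ∈ m, m.subtypeL ((T ∘L m.subtypeL).inverse (T X)) = X := by
  have hinj : Function.Injective (T ∘L m.subtypeL) := by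
    rw [injective_iff_map_eq_zero]
    intro X hX
    have : (X : E) ∈ T.ker ⊓ m := ⟨hX, X.2⟩
    rw [hm.inf_eq_bot] at this
    exact Subtype.ext this
  have hsurj : Function.Surjective (T ∘L m.subtypeL) := by
    intro w
    obtain ⟨X, rfl⟩ := hT w
    obtain ⟨Y, hY, Z, hZ, rfl⟩ := Submodule.mem_sup.1
      (show X ∈ T.ker ⊔ m by rw [hm.sup_eq_top]; trivial)
    refine ⟨⟨Z, hZ⟩, ?_⟩
    have hY' : T Y = 0 := hY
    simp [hY']
  have : FiniteDimensional ℝ F := Module.Finite.of_surjective T.toLinearMap hT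
  set e : m ≃L[ℝ] F :=
    (LinearEquiv.ofBijective (T ∘L m.subtypeL).toLinearMap ⟨hinj, hsurj⟩).toContinuousLinearEquiv
  have he : (T ∘L m.subtypeL) = (e : m →L[ℝ] F) := by ext; rfl
  rw [he, ContinuousLinearMap.inverse_equiv]
  exact ⟨fun w => e.apply_symm_apply w,
    fun X hX => congrArg Subtype.val (e.symm_apply_apply ⟨X, hX⟩)⟩

end Projection

/-! ### The projection `G → G/H` and its derivative -/

section HomogeneousSpace

set_option linter.unusedSectionVars false

variable {E : Type*} [NormedAddCommGroup E] [NormedSpace ℝ E]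
  {F : Type*} [NormedAddCommGroup F] [NormedSpace ℝ F]
  {G : Type*} [TopologicalSpace G] [ChartedSpace E G] [Group G] [LieGroup 𝓘(ℝ, E) ∞ G]
  {H : Subgroup G} [ChartedSpace F (G ⧸ H)]

variable (E F H) in
/-- The derivative `T_e π : 𝔤 → T_{eH} (G/H)` of the projection, as a map of model spaces. -/
def derivProj : E →L[ℝ] F := mfderiv 𝓘(ℝ, E) 𝓘(ℝ, F) (fun x : G => (x : G ⧸ H)) 1

/-- Smooth local sections of the projection, through every point of the group. -/
theorem exists_section
    (hπ : Manifold.IsSubmersion 𝓘(ℝ, E) 𝓘(ℝ, F) ∞ (fun g : G => (g : G ⧸ H))) (g : G) :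
    ∃ (σ : G ⧸ H → G) (U : Set (G ⧸ H)), IsOpen U ∧ (g : G ⧸ H) ∈ U ∧
      ContMDiffOn 𝓘(ℝ, F) 𝓘(ℝ, E) ∞ σ U ∧ σ g = g ∧ ∀ y ∈ U, (σ y : G ⧸ H) = y :=
  (hπ.isSubmersionAt g).exists_section

theorem mdifferentiableAt_proj
    (hπ : Manifold.IsSubmersion 𝓘(ℝ, E) 𝓘(ℝ, F) ∞ (fun g : G => (g : G ⧸ H))) (g : G) :
    MDifferentiableAt 𝓘(ℝ, E) 𝓘(ℝ, F) (fun g : G => (g : G ⧸ H)) g :=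
  (hπ.contMDiff g).mdifferentiableAt (by simp)

/-- Near `kH` the action is `y ↦ π(g σ(y))` for a local section `σ`. -/
theorem mdifferentiableAt_smul
    (hπ : Manifold.IsSubmersion 𝓘(ℝ, E) 𝓘(ℝ, F) ∞ (fun g : G => (g : G ⧸ H))) (g : G) (x : G ⧸ H) :
    MDifferentiableAt 𝓘(ℝ, F) 𝓘(ℝ, F) (fun y : G ⧸ H => g • y) x := by
  obtain ⟨k, rfl⟩ := QuotientGroup.mk_surjective x
  obtain ⟨σ, U, hU, hkU, hσ, -, hσU⟩ := exists_section hπ k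
  have h1 : ContMDiffAt 𝓘(ℝ, F) 𝓘(ℝ, F) ∞ (fun y => ((g * σ y : G) : G ⧸ H)) (k : G ⧸ H) :=
    (hπ.contMDiff _).comp (k : G ⧸ H)
      (contMDiffAt_const.mul (hσ.contMDiffAt (hU.mem_nhds hkU)))
  refine (h1.congr_of_eventuallyEq ?_).mdifferentiableAt (by simp)
  filter_upwards [hU.mem_nhds hkU] with y hy
  exact congrArg (g • ·) (hσU y hy).symm

theorem HasVelocityWithinAt.proj
    (hπ : Manifold.IsSubmersion 𝓘(ℝ, E) 𝓘(ℝ, F) ∞ (fun g : G => (g : G ⧸ H)))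
    {a : ℝ → G} {s : Set ℝ} {t : ℝ} {X : E} (ha : HasVelocityWithinAt a s t X) (ha1 : a t = 1) :
    HasVelocityWithinAt (fun r => (a r : G ⧸ H)) s t (derivProj E F H X) :=
  ha.comp_mfderiv ha1 (mdifferentiableAt_proj hπ 1)

/-- Every velocity in `G/H` lifts to `G`. -/
theorem exists_lift_velocity [IsManifold 𝓘(ℝ, F) ∞ (G ⧸ H)]
    (hπ : Manifold.IsSubmersion 𝓘(ℝ, E) 𝓘(ℝ, F) ∞ (fun g : G => (g : G ⧸ H))) (g : G) (v : F) :
    ∃ (a : ℝ → G) (X : E), a 0 = g ∧ HasVelocityWithinAt a univ 0 X ∧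
      HasVelocityWithinAt (fun r => (a r : G ⧸ H)) univ 0 v := by
  obtain ⟨f, hf0, hfs, hf⟩ := exists_curve_hasVelocityWithinAt (M := G ⧸ H) (g : G ⧸ H) v
  obtain ⟨σ, U, hU, hgU, hσ, hσg, hσU⟩ := exists_section hπ g
  refine ⟨fun r => σ (f r), _, by simp only [hf0, hσg], hf.comp_mfderiv hf0
    ((hσ.contMDiffAt (hU.mem_nhds hgU)).mdifferentiableAt (by simp)), ?_⟩
  refine hf.congr_of_eventuallyEq ?_ (by simp only [hf0, hσg])
  filter_upwards [hf.continuousWithinAt.eventually_mem (hf0 ▸ hU.mem_nhds hgU)] with r hr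
  exact hσU _ hr

theorem derivProj_surjective [IsManifold 𝓘(ℝ, F) ∞ (G ⧸ H)]
    (hπ : Manifold.IsSubmersion 𝓘(ℝ, E) 𝓘(ℝ, F) ∞ (fun g : G => (g : G ⧸ H))) :
    Function.Surjective (derivProj E F H) := by
  intro w
  obtain ⟨a, X, ha1, ha, hw⟩ := exists_lift_velocity hπ 1 w
  exact ⟨X, (ha.proj hπ ha1).unique hw uniqueDiffWithinAt_univ⟩

/-- The kernel of the derivative of the projection `G → G/H` is the Lie algebra of `H`. -/
theorem derivProj_eq_zero_iff
    (hπ : Manifold.IsSubmersion 𝓘(ℝ, E) 𝓘(ℝ, F) ∞ (fun g : G => (g : G ⧸ H))) (X : E) :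
    derivProj E F H X = 0 ↔ X ∈ (lieAlgebraOf E H : Submodule ℝ (GroupLieAlgebra 𝓘(ℝ, E) G)) := by
  classical
  constructor
  · intro hX
    obtain ⟨a, ha1, has, ha⟩ := exists_curve_one (E := E) (G := G) X
    obtain ⟨σ, U, hU, h1U, hσ, hσ1, hσU⟩ := exists_section hπ 1
    have hpa := ha.proj hπ ha1
    have hpa0 : (a 0 : G ⧸ H) = (1 : G) := by rw [ha1]
    rw [hX] at hpa
    have hσ' := hσ.contMDiffAt (hU.mem_nhds h1U)
    have hσa := hpa.comp_zero hpa0 (hσ'.mdifferentiableAt (by simp))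
    have hσa1 : σ (a 0) = 1 := by rw [hpa0, hσ1]
    -- The curve `σ(π a)⁻¹ a` lies in `H` near `0`; its first factor has zero velocity, so its
    -- velocity is `X`.
    have hγ := (hσa.inv_of_eq_one hσa1).mul_of_eq_one ha (by simp [hσa1]) ha1
    rw [neg_zero, zero_add] at hγ
    have hγs : ContMDiffAt 𝓘(ℝ, ℝ) 𝓘(ℝ, E) ∞ (fun r => (σ (a r))⁻¹ * a r) 0 := by
      have h2 : ContMDiffAt 𝓘(ℝ, ℝ) 𝓘(ℝ, F) ∞ (fun r => (a r : G ⧸ H)) 0 :=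
        (hπ.contMDiff (a 0)).comp (0 : ℝ) has
      have h3 : ContMDiffAt 𝓘(ℝ, ℝ) 𝓘(ℝ, E) ∞ (fun r => σ (a r)) 0 :=
        ContMDiffAt.comp (g := σ) (0 : ℝ) (by rw [hpa0]; exact hσ') h2
      exact h3.inv.mul has
    have hH : ∀ᶠ r in 𝓝 (0 : ℝ), (σ (a r))⁻¹ * a r ∈ H := by
      have := hpa.continuousWithinAt.eventually_mem (hpa0 ▸ hU.mem_nhds h1U)
      rw [nhdsWithin_univ] at this
      filter_upwards [this] with r hr
      exact QuotientGroup.eq.1 (hσU _ hr)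
    have hev : (fun r => if (σ (a r))⁻¹ * a r ∈ H then (σ (a r))⁻¹ * a r else 1) =ᶠ[𝓝 0]
        fun r => (σ (a r))⁻¹ * a r := by
      filter_upwards [hH] with r hr
      rw [if_pos hr]
    have h0 : (if (σ (a 0))⁻¹ * a 0 ∈ H then (σ (a 0))⁻¹ * a 0 else 1) = (σ (a 0))⁻¹ * a 0 :=
      hev.self_of_nhds
    -- Tangency demands a curve in `H` at all times, so it is replaced by `1` where it leaves `H`;
    -- nothing changes near `0`.
    refine ⟨fun r => if (σ (a r))⁻¹ * a r ∈ H then (σ (a r))⁻¹ * a r else 1, fun r => ?_,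
      hγs.congr_of_eventuallyEq hev, h0.trans (by rw [hσa1, ha1]; simp), ?_⟩
    · dsimp only
      split_ifs with h
      · exact h
      · exact H.one_mem
    · have h4 := hγ.congr_of_eventuallyEq (nhdsWithin_univ (0 : ℝ) ▸ hev) h0
      have h5 := (hasMFDerivWithinAt_univ.1 h4).mfderiv
      rw [h5]
      exact one_smul ℝ X
  · rintro ⟨γ, hγH, hγs, hγ1, hγ⟩
    have h1 : HasVelocityWithinAt γ univ 0 X := by
      have h2 := MDifferentiableWithinAt.hasVelocityWithinAt (E := E) (s := univ)
        (hγs.mdifferentiableAt (by simp)).mdifferentiableWithinAt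
      rw [mfderivWithin_univ] at h2
      exact hγ ▸ h2
    refine (h1.proj hπ hγ1).unique ?_ uniqueDiffWithinAt_univ
    refine (hasVelocityWithinAt_const ((1 : G) : G ⧸ H) univ 0).congr (fun r _ => ?_) (mem_univ _)
    exact (QuotientGroup.eq.2 (by simpa using hγH r)).symm

end HomogeneousSpace

/-! ### The canonical one-form `ω` and reconstruction of curves -/

section CanonicalForm

set_option linter.unusedSectionVars false

variable {E : Type*} [NormedAddCommGroup E] [NormedSpace ℝ E]
  {F : Type*} [NormedAddCommGroup F] [NormedSpace ℝ F]
  {G : Type*} [TopologicalSpace G] [ChartedSpace E G] [Group G] [LieGroup 𝓘(ℝ, E) ∞ G]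
  {H : Subgroup G} [ChartedSpace F (G ⧸ H)]
  {m : Submodule ℝ (GroupLieAlgebra 𝓘(ℝ, E) G)}

/-- The adjoint action, as a map of the model space. -/
def adModel (g : G) : E →L[ℝ] E := Ad E g

theorem adModel_mul_apply (g h : G) (X : E) : adModel (g * h) X = adModel g (adModel h X) :=
  Ad_mul g h X

theorem adModel_inv_adModel (g : G) (X : E) : adModel g⁻¹ (adModel g X) = X :=
  Ad_inv_Ad g X

theorem adModel_adModel_inv (g : G) (X : E) : adModel g (adModel g⁻¹ X) = X :=
  Ad_Ad_inv g X

variable (F H m) in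
/-- The projection of `𝔤` onto the reductive complement `𝔪`, as the composition of `ω_e` and
`T_e π`. -/
def complementProj : E →L[ℝ] E :=
  ContinuousLinearMap.comp (M₂ := F) (omegaAtBase (H := H) E F m) (derivProj E F H)

theorem complementProj_mem (X : E) : complementProj F H m X ∈ m :=
  Subtype.coe_prop _

variable [FiniteDimensional ℝ E] [IsManifold 𝓘(ℝ, F) ∞ (G ⧸ H)]

theorem isCompl_ker_derivProj
    (hπ : Manifold.IsSubmersion 𝓘(ℝ, E) 𝓘(ℝ, F) ∞ (fun g : G => (g : G ⧸ H)))
    (hm : IsReductiveComplement E H m) :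
    IsCompl (derivProj E F H).ker (show Submodule ℝ E from m) := by
  have : (derivProj E F H).ker = (show Submodule ℝ E from lieAlgebraOf E H) :=
    Submodule.ext fun X => derivProj_eq_zero_iff hπ X
  rw [this]
  exact hm.isCompl

theorem derivProj_complementProj
    (hπ : Manifold.IsSubmersion 𝓘(ℝ, E) 𝓘(ℝ, F) ∞ (fun g : G => (g : G ⧸ H)))
    (hm : IsReductiveComplement E H m) (X : E) :
    derivProj E F H (complementProj F H m X) = derivProj E F H X :=
  (apply_inverse_comp_subtypeL (derivProj E F H) (derivProj_surjective hπ) m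
    (isCompl_ker_derivProj hπ hm)).1 _

theorem complementProj_of_mem
    (hπ : Manifold.IsSubmersion 𝓘(ℝ, E) 𝓘(ℝ, F) ∞ (fun g : G => (g : G ⧸ H)))
    (hm : IsReductiveComplement E H m) {X : E} (hX : X ∈ m) : complementProj F H m X = X :=
  (apply_inverse_comp_subtypeL (derivProj E F H) (derivProj_surjective hπ) m
    (isCompl_ker_derivProj hπ hm)).2 X hX

-- For `h ∈ H`, the elements `h x h⁻¹` and `h x` define the same coset, so conjugation covers `Λ^h`.
omit [FiniteDimensional ℝ E] [IsManifold 𝓘(ℝ, F) ∞ (G ⧸ H)] in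
theorem derivProj_Ad
    (hπ : Manifold.IsSubmersion 𝓘(ℝ, E) 𝓘(ℝ, F) ∞ (fun g : G => (g : G ⧸ H))) {h : G} (hh : h ∈ H)
    (X : E) : derivProj E F H (adModel h X) =
      mfderiv 𝓘(ℝ, F) 𝓘(ℝ, F) (fun y : G ⧸ H => h • y) ((1 : G) : G ⧸ H) (derivProj E F H X) := by
  obtain ⟨a, ha1, -, ha⟩ := exists_curve_one (E := E) (G := G) X
  refine HasVelocityWithinAt.unique (E := F) ((ha.conj ha1 h).proj hπ (by simp [ha1])) ?_
    uniqueDiffWithinAt_univ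
  refine HasVelocityWithinAt.congr ((ha.proj hπ ha1).comp_mfderiv (p := ((1 : G) : G ⧸ H))
    (by rw [ha1]) (mdifferentiableAt_smul hπ h _)) (fun r _ => ?_) (mem_univ _)
  exact QuotientGroup.eq.2 (by simpa [mul_assoc] using hh)

/-- By `derivProj_Ad`, `Ad(h) P X` and `Ad(h) X` have the same image under `T_eπ`, hence under `P`;
and `P` fixes `Ad(h) P X`, which lies in `𝔪`. This is where the `Ad(H)`-invariance of `𝔪` enters. -/
theorem complementProj_Ad
    (hπ : Manifold.IsSubmersion 𝓘(ℝ, E) 𝓘(ℝ, F) ∞ (fun g : G => (g : G ⧸ H)))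
    (hm : IsReductiveComplement E H m) {h : G} (hh : h ∈ H) (X : E) :
    complementProj F H m (adModel h X) = adModel h (complementProj F H m X) := by
  have h1 := complementProj_of_mem hπ hm (hm.ad_mem h hh _ (complementProj_mem (F := F) (H := H) X))
  have h2 : derivProj E F H (adModel h (complementProj F H m X)) = derivProj E F H (adModel h X) := by
    rw [derivProj_Ad hπ hh, derivProj_Ad hπ hh, derivProj_complementProj hπ hm]
  refine Eq.trans ?_ h1
  exact (congrArg (omegaAtBase (H := H) E F m) h2).symm

/-- The value of `ω` on the velocity of the projection of a curve in `G`. -/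
theorem omegaVia_eq
    (hπ : Manifold.IsSubmersion 𝓘(ℝ, E) 𝓘(ℝ, F) ∞ (fun g : G => (g : G ⧸ H)))
    {a : ℝ → G} {s : Set ℝ} {t : ℝ} (hs : UniqueDiffWithinAt ℝ s t) {X : E} {x : G ⧸ H} {v : F}
    (hx : x = a t) (ha : HasRightLogDerivWithinAt a s t X)
    (hv : HasVelocityWithinAt (fun r => (a r : G ⧸ H)) s t v) :
    omegaVia E F m (a t) ⟨x, v⟩ = adModel (a t) (complementProj F H m (adModel (a t)⁻¹ X)) := by
  subst hx
  have h1 := hv.comp_mfderiv rfl (mdifferentiableAt_smul hπ (a t)⁻¹ (a t : G ⧸ H))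
  have h2 := (HasVelocityWithinAt.conj ha (by simp) (a t)⁻¹).proj hπ (by simp)
  have h3 := h1.unique (h2.congr_of_eventuallyEq (Filter.Eventually.of_forall fun r => ?_) ?_) hs
  · exact congrArg (fun w : F => Ad E (a t) (omegaAtBase (H := H) E F m w)) h3
  · exact congrArg (QuotientGroup.mk (s := H)) (by simp [mul_assoc])
  · exact congrArg (QuotientGroup.mk (s := H)) (by simp)

/-- The value `Ad(g) ω_e (T Λ^{g⁻¹} v)` depends only on the coset of `g`. -/
theorem omegaVia_eq_of_mk_eq
    (hπ : Manifold.IsSubmersion 𝓘(ℝ, E) 𝓘(ℝ, F) ∞ (fun g : G => (g : G ⧸ H)))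
    (hm : IsReductiveComplement E H m) {g k : G} (hgk : (g : G ⧸ H) = k) (v : F) :
    omegaVia E F m g ⟨(k : G ⧸ H), v⟩ = omegaVia E F m k ⟨(k : G ⧸ H), v⟩ := by
  obtain ⟨h, hh, rfl⟩ : ∃ h ∈ H, k * h = g :=
    ⟨k⁻¹ * g, QuotientGroup.eq.1 hgk.symm, by simp⟩
  -- Both `a` and `a h` lift the same curve with velocity `v` and have the same logarithmic
  -- derivative; the two values of the formula are compared.
  obtain ⟨a, Y, ha0, ha, hav⟩ := exists_lift_velocity hπ k v
  obtain ⟨X, hX⟩ := ha.exists_hasRightLogDerivWithinAt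
  have hmk : ∀ r, ((a r * h : G) : G ⧸ H) = a r := fun r => QuotientGroup.eq.2 (by simpa using hh)
  have h1 := omegaVia_eq (m := m) (x := (k : G ⧸ H)) hπ uniqueDiffWithinAt_univ (by rw [ha0]) hX hav
  have h2 := omegaVia_eq (m := m) (x := (k : G ⧸ H)) hπ uniqueDiffWithinAt_univ
    (by rw [hmk, ha0]) (hX.mul_const h) (hav.congr (fun r _ => hmk r) (mem_univ _))
  rw [ha0] at h1 h2
  rw [h1, h2, adModel_mul_apply, mul_inv_rev, adModel_mul_apply, ← complementProj_Ad hπ hm hh,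
    adModel_adModel_inv]

/-- The value of the canonical form on the velocity of the projection of a curve in `G`. -/
theorem omega_eq
    (hπ : Manifold.IsSubmersion 𝓘(ℝ, E) 𝓘(ℝ, F) ∞ (fun g : G => (g : G ⧸ H)))
    (hm : IsReductiveComplement E H m)
    {a : ℝ → G} {s : Set ℝ} {t : ℝ} (hs : UniqueDiffWithinAt ℝ s t) {X : E} {x : G ⧸ H} {v : F}
    (hx : x = a t) (ha : HasRightLogDerivWithinAt a s t X)
    (hv : HasVelocityWithinAt (fun r => (a r : G ⧸ H)) s t v) :
    omega E F m ⟨x, v⟩ = adModel (a t) (complementProj F H m (adModel (a t)⁻¹ X)) := by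
  subst hx
  exact (omegaVia_eq_of_mk_eq hπ hm (QuotientGroup.out_eq' _) v).trans (omegaVia_eq hπ hs rfl ha hv)

/-- Smooth curves in `G/H` lift locally to smooth curves in `G`. -/
theorem exists_lift_curve
    (hπ : Manifold.IsSubmersion 𝓘(ℝ, E) 𝓘(ℝ, F) ∞ (fun g : G => (g : G ⧸ H)))
    {c : ℝ → G ⧸ H} {s : Set ℝ} (hc : ContMDiffOn 𝓘(ℝ, ℝ) 𝓘(ℝ, F) ∞ c s) {t₀ : ℝ} (ht₀ : t₀ ∈ s) :
    ∃ (W : Set ℝ) (a : ℝ → G), IsOpen W ∧ t₀ ∈ W ∧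
      ContMDiffOn 𝓘(ℝ, ℝ) 𝓘(ℝ, E) ∞ a (s ∩ W) ∧ ∀ t ∈ s ∩ W, (a t : G ⧸ H) = c t := by
  obtain ⟨k, hk⟩ := QuotientGroup.mk_surjective (c t₀)
  obtain ⟨σ, U, hU, hkU, hσ, -, hσU⟩ := exists_section hπ k
  obtain ⟨W, hW, htW, hWU⟩ := mem_nhdsWithin.1 <| (hc t₀ ht₀).continuousWithinAt
    (show U ∈ 𝓝 (c t₀) from hk ▸ hU.mem_nhds hkU)
  exact ⟨W, fun t => σ (c t), hW, htW, hσ.comp (hc.mono inter_subset_left)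
    fun t ht => hWU ⟨ht.2, ht.1⟩, fun t ht => hσU _ (hWU ⟨ht.2, ht.1⟩)⟩

variable {c : unitInterval → G ⧸ H}

/-- Along a smooth curve `c` in `G/H`, locally there is a smooth lift `a` to `G` whose right
logarithmic derivative `X` determines `ω(ċ)`. -/
theorem exists_lift_thetaOmega
    (hπ : Manifold.IsSubmersion 𝓘(ℝ, E) 𝓘(ℝ, F) ∞ (fun g : G => (g : G ⧸ H)))
    (hm : IsReductiveComplement E H m) (hc : ContMDiff (𝓡∂ 1) 𝓘(ℝ, F) ∞ c) {t₀ : ℝ}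
    (ht₀ : t₀ ∈ Icc (0 : ℝ) 1) :
    ∃ (W : Set ℝ) (a : ℝ → G) (X : ℝ → E), IsOpen W ∧ t₀ ∈ W ∧
      ContMDiffOn 𝓘(ℝ, ℝ) 𝓘(ℝ, E) ∞ a (Icc 0 1 ∩ W) ∧ ContDiffOn ℝ ∞ X (Icc 0 1 ∩ W) ∧
      ∀ t ∈ Icc 0 1 ∩ W, (a t : G ⧸ H) = extend c t ∧
        HasRightLogDerivWithinAt a (Icc 0 1 ∩ W) t (X t) ∧
        extend (thetaOmega E F m (derivCurve F c)) t =
          adModel (a t) (complementProj F H m (adModel (a t)⁻¹ (X t))) := by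
  obtain ⟨W, a, hW, htW, ha, hac⟩ := exists_lift_curve hπ (contMDiffOn_extend_iff.2 hc) ht₀
  have hu : UniqueDiffOn ℝ (Icc 0 1 ∩ W) := (uniqueDiffOn_Icc zero_lt_one).inter hW
  obtain ⟨X, hX, haX⟩ := exists_contDiffOn_hasRightLogDerivWithinAt hu ha
  refine ⟨W, a, X, hW, htW, ha, hX, fun t ht => ⟨hac t ht, haX t ht, ?_⟩⟩
  obtain ⟨ht1, ht2⟩ := ht
  lift t to unitInterval using ht1
  rw [extend_coe]
  have hv := (hasVelocityWithinAt_velocity (E := F) (t := t)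
    ((hc t).mdifferentiableAt (by simp))).mono (inter_subset_left (t := W))
  exact omega_eq hπ hm (hu t ⟨t.2, ht2⟩) ((extend_coe c t).symm.trans (hac t ⟨t.2, ht2⟩).symm)
    (haX t ⟨t.2, ht2⟩) (hv.congr hac ⟨t.2, ht2⟩)

theorem thetaOmega_derivCurve_mem_smoothLieCurves
    (hπ : Manifold.IsSubmersion 𝓘(ℝ, E) 𝓘(ℝ, F) ∞ (fun g : G => (g : G ⧸ H)))
    (hm : IsReductiveComplement E H m) (hc : ContMDiff (𝓡∂ 1) 𝓘(ℝ, F) ∞ c) :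
    thetaOmega E F m (derivCurve F c) ∈ smoothLieCurves E G := by
  refine (contMDiffOn_extend_iff (M := E)).1 (contMDiffOn_iff_contDiffOn.2 fun t₀ ht₀ => ?_)
  obtain ⟨W, a, X, hW, htW, ha, hX, h⟩ := exists_lift_thetaOmega hπ hm hc ht₀
  have ht : t₀ ∈ Icc 0 1 ∩ W := ⟨ht₀, htW⟩
  have hA : ContDiffWithinAt ℝ ∞ (fun t => adModel (E := E) (a t)) (Icc 0 1 ∩ W) t₀ :=
    contDiffWithinAt_Ad (ha t₀ ht) ht
  have hA' : ContDiffWithinAt ℝ ∞ (fun t => adModel (E := E) (a t)⁻¹) (Icc 0 1 ∩ W) t₀ :=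
    contDiffWithinAt_Ad (ha t₀ ht).inv ht
  have h1 : ContDiffWithinAt ℝ ∞ (F := E)
      (fun t => adModel (a t) (complementProj F H m (adModel (a t)⁻¹ (X t)))) (Icc 0 1 ∩ W) t₀ :=
    hA.clm_apply ((complementProj F H m).contDiff.comp_contDiffWithinAt
      (hA'.clm_apply (hX t₀ ht)))
  exact (h1.congr (fun t ht => (h t ht).2.2) (h t₀ ht).2.2).mono_of_mem_nhdsWithin
    (Filter.inter_mem self_mem_nhdsWithin (mem_nhdsWithin_of_mem_nhds (hW.mem_nhds htW)))

/-- The evolution of `ω(ċ)` moves `c(0)` along `c`. -/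
theorem IsEvolution.smul_eq
    (hπ : Manifold.IsSubmersion 𝓘(ℝ, E) 𝓘(ℝ, F) ∞ (fun g : G => (g : G ⧸ H)))
    (hm : IsReductiveComplement E H m) (hc : ContMDiff (𝓡∂ 1) 𝓘(ℝ, F) ∞ c) {g : unitInterval → G}
    (hg : IsEvolution E (thetaOmega E F m (derivCurve F c)) g) (t : unitInterval) :
    g t • c 0 = c t := by
  have hM : IsManifold 𝓘(ℝ, F) 1 (G ⧸ H) := .of_le (n := ∞) (by norm_cast)
  have hzero : ∀ t ∈ Icc (0 : ℝ) 1,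
      HasVelocityWithinAt (fun r => (extend g r)⁻¹ • extend c r) (Icc 0 1) t (0 : F) := by
    intro t ht
    obtain ⟨W, a, X, hW, htW, ha, hX, h⟩ := exists_lift_thetaOmega hπ hm hc ht
    obtain ⟨hac, haX, hq⟩ := h t ⟨ht, htW⟩
    obtain ⟨q, hqt⟩ : ∃ q : E, q = extend (thetaOmega E F m (derivCurve F c)) t := ⟨_, rfl⟩
    have hgq : HasRightLogDerivWithinAt (extend g) (Icc 0 1 ∩ W) t q :=
      hqt ▸ (hg.hasRightLogDerivWithinAt t ht).mono (inter_subset_left (t := W))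
    replace hq := hqt.trans hq
    have hb := HasVelocityWithinAt.conj (hgq.inv_mul haX) (by simp) (a t)⁻¹
    have hAd : adModel (a t)⁻¹ q =
        complementProj F H m (adModel (a t)⁻¹ (X t)) := by
      rw [hq, adModel_inv_adModel]
    have hker : derivProj E F H
        (adModel (a t)⁻¹ (-q + X t)) = 0 := by
      rw [map_add, map_neg, hAd, map_add, map_neg, derivProj_complementProj hπ hm, neg_add_cancel]
    have hp : HasVelocityWithinAt _ _ _ (derivProj E F H (adModel (a t)⁻¹ (-q + X t))) :=
      HasVelocityWithinAt.proj hπ hb (by simp)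
    -- `hp` concerns the coset of `a(t)⁻¹ g(t) g(r)⁻¹ a(r)`; translation by `g(t)⁻¹ a(t)` turns it
    -- into `g(r)⁻¹.c(r)`.
    have hs := (hker ▸ hp).comp_zero rfl (mdifferentiableAt_smul hπ ((extend g t)⁻¹ * a t) _)
    have hs' : HasVelocityWithinAt (fun r => (extend g r)⁻¹ • extend c r) (Icc 0 1 ∩ W) t (0 : F) := by
      refine hs.congr (fun r hr => ?_) ⟨ht, htW⟩
      rw [← (h r hr).1]
      exact congrArg (QuotientGroup.mk (s := H)) (by simp [mul_assoc])
    exact hs'.mono_of_mem_nhdsWithin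
      (Filter.inter_mem self_mem_nhdsWithin (mem_nhdsWithin_of_mem_nhds (hW.mem_nhds htW)))
  have h := eq_of_hasVelocityWithinAt_zero hzero t t.2 0 (left_mem_Icc.2 zero_le_one)
  simp only [extend_coe] at h
  have h0 : ∀ {Y : Type _} (f : unitInterval → Y), extend f 0 = f 0 := fun f => extend_coe f 0
  rw [h0, h0, hg.start, inv_one, one_smul] at h
  rw [← h, smul_inv_smul]

end CanonicalForm

end ReductiveSpace
end

/-! ### The main theorem -/

theorem proposition3p6
    {E : Type*} [NormedAddCommGroup E] [NormedSpace ℝ E] [FiniteDimensional ℝ E]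
    {F : Type*} [NormedAddCommGroup F] [NormedSpace ℝ F] [FiniteDimensional ℝ F]
    {G : Type*} [TopologicalSpace G] [ChartedSpace E G] [Group G] [LieGroup 𝓘(ℝ, E) ∞ G]
    (H : Subgroup G) (hH : IsClosed (H : Set G))
    [ChartedSpace F (G ⧸ H)] [IsManifold 𝓘(ℝ, F) ∞ (G ⧸ H)]
    (hπ : Manifold.IsSubmersion 𝓘(ℝ, E) 𝓘(ℝ, F) ∞ (fun g : G => (g : G ⧸ H)))
    (m : Submodule ℝ (GroupLieAlgebra 𝓘(ℝ, E) G))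
    (hm : ReductiveSpace.IsReductiveComplement E H m)
    (c₀ : G ⧸ H) :
    (∀ (g : G) (v : TangentSpace 𝓘(ℝ, F) (g : G ⧸ H)),
      ReductiveSpace.omega E F m ⟨(g : G ⧸ H), v⟩ =
        ReductiveSpace.omegaVia E F m g ⟨(g : G ⧸ H), v⟩) ∧
    (∀ c ∈ ReductiveSpace.smoothCurvesFrom F c₀,
      ReductiveSpace.thetaOmega E F m (ReductiveSpace.derivCurve F c) ∈
          ReductiveSpace.smoothLieCurves E G ∧
        ∃! g : unitInterval → G, ReductiveSpace.IsEvolution E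
          (ReductiveSpace.thetaOmega E F m (ReductiveSpace.derivCurve F c)) g) ∧
    EqOn (ReductiveSpace.rho E c₀ ∘ ReductiveSpace.thetaOmega E F m ∘ ReductiveSpace.derivCurve F)
      id (ReductiveSpace.smoothCurvesFrom F c₀) := by
  have : CompleteSpace E := FiniteDimensional.complete ℝ E
  have key : ∀ c ∈ ReductiveSpace.smoothCurvesFrom F c₀,
      ReductiveSpace.thetaOmega E F m (ReductiveSpace.derivCurve F c) ∈
          ReductiveSpace.smoothLieCurves E G ∧
        ∃! g : unitInterval → G, ReductiveSpace.IsEvolution E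
          (ReductiveSpace.thetaOmega E F m (ReductiveSpace.derivCurve F c)) g := fun c hc =>
    have h := ReductiveSpace.thetaOmega_derivCurve_mem_smoothLieCurves hπ hm hc.1
    ⟨h, ReductiveSpace.existsUnique_isEvolution h⟩
  refine ⟨fun g v => ReductiveSpace.omegaVia_eq_of_mk_eq hπ hm (QuotientGroup.out_eq' _) v, key,
    fun c hc => funext fun t => ?_⟩
  have hex := (key c hc).2.exists
  have hg : ReductiveSpace.IsEvolution E
      (ReductiveSpace.thetaOmega E F m (ReductiveSpace.derivCurve F c))
      (ReductiveSpace.Evol E (ReductiveSpace.thetaOmega E F m (ReductiveSpace.derivCurve F c))) := by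
    -- Existence rules out the dummy value in `Evol`.
    rw [ReductiveSpace.Evol, dif_pos hex]
    exact hex.choose_spec
  have h := hg.smul_eq hπ hm hc.1 t
  rw [hc.2] at h
  exact h
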